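/- Let $E_1,\dots,E_k$ and $E^1,\dots,E^m$ be Euclidean spaces (finite-dimensional real Hilbert spaces with Lebesgue measure), let $E_0=\bigoplus_{i=1}^k E_i$ be the orthogonal direct sum with canonical projections $\pi_{E_i}:E_0\to E_i$, and fix positive reals $\mathbf d=(d_j)_{j=1}^m$ and linear maps $\mathbf B=(B_j)_{j=1}^m$, $B_j:E_0\to E^j$. For a random vector $X$ with law $\mu$ on a Euclidean space, let $h(X)=-\int \log\frac{d\mu}{dx}\,d\mu\in[-\infty,\infty]$ be the Shannon entropy, with $h(X)=-\infty$ if $\mu$ is not absolutely continuous. Let $\mathcal G(E)$ be the set of Gaussian measures (of arbitrary mean) on $E$ with finite entropy. For $\mathbf c\in\mathbb R^k$ define $$D_g(\mathbf c,\mathbf d,\mathbf B)=\sup_{Z_i\in\mathcal G(E_i),\,1\le i\le k}\Big(\sum_{i=1}^k c_i h(Z_i)-\max_{Z}\sum_{j=1}^m d_j h(B_jZ)\Big)\in[-\infty,\infty],$$ where $Z$ ranges over all couplings of $Z_1,\dots,Z_k$, i.e. random vectors in $E_0$ with $\pi_{E_i}(Z)\overset{law}{=}Z_i$ for all $i$ (the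 maximum being read as a supremum in $[-\infty,\infty]$). Let $\mathrm{PD}(E)$ be the set of symmetric positive definite operators on $E$. For $K_i\in \mathrm{PD}(E_i)$ let $\Pi(K_1,\dots,K_k)$ be the set of symmetric positive semidefinite operators $K$ on $E_0$ with $\pi_{E_i}K\pi_{E_i}^T=K_i$ for all $i$. With $\log 0=-\infty$, define $$F(\mathbf c,(K_i)_{i=1}^k)=\max_{K\in\Pi(K_1,\dots,K_k)}\sum_{j=1}^m d_j\log\det(B_jKB_j^T)-\sum_{i=1}^k c_i\log\det K_i\in\mathbb R\cup\{-\infty\}.$$ Equip $\mathrm{PD}(E)$ with the metric $\delta_2(A,B)=\big(\sum_{i=1}^{\dim E}(\log\lambda_i(A^{-1}B))^2\big)^{1/2}$, where $\lambda_i(A^{-1}B)$ are the eigenvalues of $A^{-1}B$ with multiplicity, and $M=\prod_{i=1}^k\mathrm{PD}(E_i)$ with the product metric $\rho(K,L)=\big(\sum_{i=1}^k\delta_2(K_i,L_i)^2\big)^{1/2}$. A geodesic in $M$ is a path $\gamma:[0,1]\to M$ with $\rho(\gamma(s),\gamma(t))=|s-t|\,\rho(\gamma(0),\gamma(1))$ for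 all $s,t\in[0,1]$; a function $f:M\to\mathbb R\cup\{-\infty\}$ is geodesically convex if $f(\gamma(t))\le(1-t)f(\gamma(0))+t f(\gamma(1))$ for every geodesic $\gamma$ and every $t\in[0,1]$, with the convention $0\cdot(-\infty)=0$. Theorem. Fix $(\mathbf d,\mathbf B)$. (i) The function $\mathbf c\mapsto D_g(\mathbf c,\mathbf d,\mathbf B)$ is convex and lower semicontinuous on $\mathbb R^k$ (as an extended-real-valued function, with the convention $0\cdot(\pm\infty)=0$ in the convexity inequality). (ii) The maximum in the definition of $F$ is attained for every $(K_i)_{i=1}^k\in M$, and for each fixed $\mathbf c\in\mathbb R^k$ the function $(K_i)_{i=1}^k\mapsto F(\mathbf c,(K_i)_{i=1}^k)$ is geodesically convex and continuous on $M=\prod_{i=1}^k\mathrm{PD}(E_i)$ (continuous for the usual topology and with values in $\mathbb R\cup\{-\infty\}$). -/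

import Mathlib

open MeasureTheory ProbabilityTheory
open scoped ENNReal InnerProductSpace

noncomputable section

namespace BrascampLieb

section Entropy

variable {E : Type*} [NormedAddCommGroup E] [InnerProductSpace ℝ E] [FiniteDimensional ℝ E]
  [MeasurableSpace E] [BorelSpace E]

open Classical in
/-- Shannon entropy `h(μ) = -∫ log (dμ/dx) dμ` of a law `μ` on a Euclidean space, as an extended
real: the integral of the positive part of `-log (dμ/dx)` minus the integral of its negative part.
It is `-∞` if `μ` is not absolutely continuous. -/
def entropy (μ : Measure E) : EReal :=
  if μ ≪ (volume : Measure E) then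
    ((∫⁻ x, ENNReal.ofReal (-Real.log (μ.rnDeriv volume x).toReal) ∂μ : ℝ≥0∞) : EReal) -
      ((∫⁻ x, ENNReal.ofReal (Real.log (μ.rnDeriv volume x).toReal) ∂μ : ℝ≥0∞) : EReal)
  else ⊥

variable (E) in
/-- `𝒫(E)`: the probability measures on `E` with finite entropy and finite second moment. -/
def finiteEntropyLaws : Set (Measure E) :=
  {μ | IsProbabilityMeasure μ ∧ entropy μ ≠ ⊥ ∧ entropy μ ≠ ⊤ ∧
    ∫⁻ x, ENNReal.ofReal (‖x‖ ^ 2) ∂μ < ∞}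

variable (E) in
/-- `𝒢(E)`: the Gaussian measures (of arbitrary mean) in `𝒫(E)`. -/
def gaussianLaws : Set (Measure E) :=
  {μ | μ ∈ finiteEntropyLaws E ∧ IsGaussian μ}

end Entropy

section Operators

variable {E : Type*} [NormedAddCommGroup E] [InnerProductSpace ℝ E] [FiniteDimensional ℝ E]

variable (E) in
/-- The symmetric positive definite operators on a Euclidean space `E`. -/
def posDef : Set (E →L[ℝ] E) :=
  {A | (∀ x y : E, ⟪A x, y⟫_ℝ = ⟪x, A y⟫_ℝ) ∧ ∀ x : E, x ≠ 0 → 0 < ⟪x, A x⟫_ℝ}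

/-- `log det A`, with `log 0 = -∞`; it is used for positive semidefinite `A` only. -/
def logDet (A : E →L[ℝ] E) : EReal :=
  ENNReal.log (ENNReal.ofReal A.det)

/-- `δ₂(A, B) = (∑ᵢ (log λᵢ(A⁻¹ B))²)^(1/2)`, where the `λᵢ(A⁻¹ B)` are the eigenvalues of `A⁻¹ B`
(the roots of its characteristic polynomial) with multiplicity. -/
def deltaTwo (A B : E →L[ℝ] E) : ℝ :=
  Real.sqrt (((LinearMap.charpoly ((A.inverse ∘L B : E →L[ℝ] E) : E →ₗ[ℝ] E)).roots.map
    fun l => Real.log l ^ 2).sum)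

end Operators

section Geodesics

/-- `γ`, restricted to `[0,1]`, is a geodesic in the set `M` with the distance function `ρ`. -/
def IsGeodesic {X : Type*} (ρ : X → X → ℝ) (M : Set X) (γ : ℝ → X) : Prop :=
  (∀ t ∈ Set.Icc (0 : ℝ) 1, γ t ∈ M) ∧
    ∀ s ∈ Set.Icc (0 : ℝ) 1, ∀ t ∈ Set.Icc (0 : ℝ) 1,
      ρ (γ s) (γ t) = |s - t| * ρ (γ 0) (γ 1)

/-- `f` is convex along every geodesic of `M`. -/
def GeodesicallyConvex {X : Type*} (ρ : X → X → ℝ) (M : Set X) (f : X → EReal) : Prop :=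
  ∀ γ : ℝ → X, IsGeodesic ρ M γ → ∀ t ∈ Set.Icc (0 : ℝ) 1,
    f (γ t) ≤ ((1 - t : ℝ) : EReal) * f (γ 0) + (t : EReal) * f (γ 1)

end Geodesics

section Datum

variable {k m : ℕ}
  {E : Fin k → Type*} [∀ i, NormedAddCommGroup (E i)] [∀ i, InnerProductSpace ℝ (E i)]
  [∀ i, FiniteDimensional ℝ (E i)]
  {E' : Fin m → Type*} [∀ j, NormedAddCommGroup (E' j)] [∀ j, InnerProductSpace ℝ (E' j)]
  [∀ j, FiniteDimensional ℝ (E' j)]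

section Laws

variable [∀ i, MeasurableSpace (E i)] [∀ i, BorelSpace (E i)]
  [∀ j, MeasurableSpace (E' j)] [∀ j, BorelSpace (E' j)]

/-- `Π(μ₁, …, μ_k)`: the laws on the orthogonal direct sum `E₀ = ⨁ᵢ Eᵢ` with marginals `μᵢ`. -/
def couplings (μ : ∀ i, Measure (E i)) : Set (Measure (PiLp 2 E)) :=
  {P | IsProbabilityMeasure P ∧ ∀ i, P.map (PiLp.proj (𝕜 := ℝ) 2 E i) = μ i}

/-- The maximum over couplings `X` of the `μᵢ` of `∑ⱼ dⱼ h(Bⱼ X)`, as a supremum in `[-∞, ∞]`. -/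
def maxCouplingEntropy (d : Fin m → ℝ) (B : ∀ j, PiLp 2 E →L[ℝ] E' j)
    (μ : ∀ i, Measure (E i)) : EReal :=
  ⨆ P ∈ couplings μ, ∑ j, (d j : EReal) * entropy (P.map (B j))

/-- The Gaussian constant `D_g(c, d, B)`. -/
def gaussianConstant (c : Fin k → ℝ) (d : Fin m → ℝ) (B : ∀ j, PiLp 2 E →L[ℝ] E' j) : EReal :=
  ⨆ μ ∈ {μ : ∀ i, Measure (E i) | ∀ i, μ i ∈ gaussianLaws (E i)},
    (∑ i, (c i : EReal) * entropy (μ i) - maxCouplingEntropy d B μ)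

end Laws

variable (E) in
/-- `∏ᵢ PD(Eᵢ)`. -/
def posDefTuples : Set (∀ i, E i →L[ℝ] E i) :=
  {K | ∀ i, K i ∈ posDef (E i)}

/-- The `ℓ²` product of the metrics `δ₂` on the factors of `∏ᵢ PD(Eᵢ)`. -/
def deltaTwoProd (K L : ∀ i, E i →L[ℝ] E i) : ℝ :=
  Real.sqrt (∑ i, deltaTwo (K i) (L i) ^ 2)

/-- `Π(K₁, …, K_k)`: the positive semidefinite operators `S` on `E₀ = ⨁ᵢ Eᵢ` with
`πᵢ S πᵢᵀ = Kᵢ` for every `i`. -/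
def matrixCouplings (K : ∀ i, E i →L[ℝ] E i) : Set (PiLp 2 E →L[ℝ] PiLp 2 E) :=
  {S | S.IsPositive ∧ ∀ i, PiLp.proj (𝕜 := ℝ) 2 E i ∘L S ∘L
    ContinuousLinearMap.adjoint (PiLp.proj (𝕜 := ℝ) 2 E i) = K i}

/-- `∑ⱼ dⱼ log det (Bⱼ S Bⱼᵀ)`. -/
def logDetSum (d : Fin m → ℝ) (B : ∀ j, PiLp 2 E →L[ℝ] E' j)
    (S : PiLp 2 E →L[ℝ] PiLp 2 E) : EReal :=
  ∑ j, (d j : EReal) * logDet (B j ∘L S ∘L ContinuousLinearMap.adjoint (B j))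

/-- `F(c, (Kᵢ)ᵢ) = max_{S ∈ Π(K₁, …, K_k)} ∑ⱼ dⱼ log det (Bⱼ S Bⱼᵀ) - ∑ᵢ cᵢ log det Kᵢ`. -/
def objectiveF (c : Fin k → ℝ) (d : Fin m → ℝ) (B : ∀ j, PiLp 2 E →L[ℝ] E' j)
    (K : ∀ i, E i →L[ℝ] E i) : EReal :=
  (⨆ S ∈ matrixCouplings K, logDetSum d B S) - ∑ i, (c i : EReal) * logDet (K i)

end Datum

end BrascampLieb

end

/-!
The Gaussian constant is a supremum over tuples of Gaussian laws of functions of `c`, each of which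
is either identically `±∞` or real and affine. Convexity and lower semicontinuity follow
(`gaussianConstant_convex`, `lowerSemicontinuous_gaussianConstant`).

For `F` one passes to matrices in orthonormal bases and replaces `∑ⱼ dⱼ log det (Bⱼ S Bⱼᵀ)` by its
exponential `detProd`, a continuous nonnegative function of `S`. The couplings form a compact set,
so the maximum is attained. If `K - r L` is positive definite, then `r S` plus a block diagonal
matrix is a coupling of `K` for every coupling `S` of `L`; since `det` is monotone and homogeneous,
the maximum at `K` is at least `r ^ N` times the maximum at `L`, and letting `r → 1` gives continuity
(`continuousOn_maxDetProd`). If some `Bⱼ` is not surjective the maximum vanishes and `F` is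
identically `-∞`; otherwise it is positive.

Geodesic convexity of the maximum rests on duality. If `∑ⱼ dⱼ Bⱼᵀ Vⱼ Bⱼ ≤ diag (Uᵢ)`, then
`∑ⱼ dⱼ log det (Bⱼ S Bⱼᵀ) ≤ ∑ᵢ tr (Uᵢ Kᵢ) - ∑ⱼ dⱼ dim Eʲ - ∑ⱼ dⱼ log det Vⱼ` for every coupling `S`
(`log_detProd_le_of_dual`). The bound is sharp up to an arbitrarily small error: the maximiser of
the functional regularised by `ε log det S` is positive definite, and its stationarity says that the
gradient is block diagonal, which yields `U` and `V` (`exists_dual_certificate`). Take such pairs at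
the two end points of a geodesic and join them by geodesics. The constraint persists by the three
lines theorem (`posSemidef_sub_of_geodesic`), the terms `tr (Uᵢ Kᵢ)` are convex and the terms
`log det Vⱼ` affine, so that the bound at an intermediate point is at most the interpolated bound
(`detProd_le_rpow_mul_rpow`). The term `∑ᵢ cᵢ log det Kᵢ` is affine along geodesics.

It remains to know the metric geodesics. For positive definite `P`, `Q` with logarithms `L`, `L'`,
`‖L - L'‖² ≤ tr (P⁻¹ Q) + tr (Q⁻¹ P) - 2 n ≤ δ₂(P, Q)² exp (δ₂(P, Q)² / 2)`, and the middle term is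
invariant under congruence. So, after the initial point is moved to the identity, the logarithm of a
geodesic has infinitesimal speed at most the distance of its end points, which is also the norm of
its final value; it is therefore a straight segment (`exists_diagonal_of_isGeodesic`). Hence every
geodesic has the form `t ↦ Nᵢ diag (exp (t hᵢ)) Nᵢᵀ`.
-/

open Matrix
open scoped Topology

set_option linter.unusedSectionVars false

namespace BrascampLieb

/-! ### Congruence, traces and determinants of positive definite matrices -/

section MatrixBasics

variable {n : Type*} [Fintype n] [DecidableEq n]

/-- The spectral theorem for real symmetric matrices. -/
theorem exists_orthogonal_diagonal {A : Matrix n n ℝ} (hA : A.IsHermitian) :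
    ∃ (O : Matrix n n ℝ) (a : n → ℝ), O * Oᵀ = 1 ∧ Oᵀ * O = 1 ∧ A = O * diagonal a * Oᵀ := by
  refine ⟨hA.eigenvectorUnitary, hA.eigenvalues, ?_, ?_, ?_⟩
  · have := Unitary.mul_star_self_of_mem hA.eigenvectorUnitary.2
    rwa [star_eq_conjTranspose, conjTranspose_eq_transpose_of_trivial] at this
  · have := Unitary.star_mul_self_of_mem hA.eigenvectorUnitary.2
    rwa [star_eq_conjTranspose, conjTranspose_eq_transpose_of_trivial] at this
  · have := hA.spectral_theorem
    rw [Unitary.conjStarAlgAut_apply, star_eq_conjTranspose,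
      conjTranspose_eq_transpose_of_trivial] at this
    exact this

theorem exists_orthogonal_exp {A : Matrix n n ℝ} (hA : A.PosDef) :
    ∃ (O : Matrix n n ℝ) (a : n → ℝ), O * Oᵀ = 1 ∧ Oᵀ * O = 1 ∧
      A = O * diagonal (fun x => Real.exp (a x)) * Oᵀ := by
  obtain ⟨O, a, h1, h2, h3⟩ := exists_orthogonal_diagonal hA.isHermitian
  have hD : diagonal a = Oᵀ * A * O := by
    rw [h3, ← Matrix.mul_assoc, ← Matrix.mul_assoc, h2, Matrix.one_mul, Matrix.mul_assoc, h2,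
      Matrix.mul_one]
  have hO : IsUnit O := IsUnit.of_mul_eq_one _ h1
  have hpos : (diagonal a).PosDef := by
    rw [hD, ← conjTranspose_eq_transpose_of_trivial]
    exact hA.conjTranspose_mul_mul_same (Matrix.mulVec_injective_of_isUnit hO)
  rw [posDef_diagonal_iff] at hpos
  refine ⟨O, fun x => Real.log (a x), h1, h2, ?_⟩
  rw [h3]
  congr 3
  ext x
  exact (Real.exp_log (hpos x)).symm

theorem posDef_mul_diagonal_exp_mul_transpose {N : Matrix n n ℝ} (hN : IsUnit N) (h : n → ℝ) :
    (N * diagonal (fun x => Real.exp (h x)) * Nᵀ).PosDef := by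
  rw [← conjTranspose_eq_transpose_of_trivial]
  refine PosDef.mul_mul_conjTranspose_same ?_ (Matrix.vecMul_injective_of_isUnit hN)
  rw [posDef_diagonal_iff]
  exact fun x => Real.exp_pos _

theorem exists_isUnit_mul_transpose {A : Matrix n n ℝ} (hA : A.PosDef) :
    ∃ R : Matrix n n ℝ, IsUnit R ∧ A = R * Rᵀ := by
  obtain ⟨O, a, h1, h2, h3⟩ := exists_orthogonal_exp hA
  refine ⟨O * diagonal (fun x => Real.exp (a x / 2)), ?_, ?_⟩
  · refine (IsUnit.of_mul_eq_one _ h1).mul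
      (IsUnit.of_mul_eq_one (diagonal (fun x => Real.exp (-(a x / 2)))) ?_)
    rw [diagonal_mul_diagonal]
    simp [← Real.exp_add]
  · rw [h3, transpose_mul, diagonal_transpose, ← Matrix.mul_assoc,
      Matrix.mul_assoc O (diagonal fun x => Real.exp (a x / 2)),
      diagonal_mul_diagonal]
    simp [← Real.exp_add]

/-- Simultaneous diagonalisation of two positive definite forms by congruence. -/
theorem exists_simultaneous_diagonalization {A B : Matrix n n ℝ} (hA : A.PosDef) (hB : B.PosDef) :
    ∃ (N : Matrix n n ℝ) (h : n → ℝ), IsUnit N ∧ A = N * Nᵀ ∧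
      B = N * diagonal (fun x => Real.exp (h x)) * Nᵀ := by
  obtain ⟨R, hR, rfl⟩ := exists_isUnit_mul_transpose hA
  have hdet : IsUnit R.det := (Matrix.isUnit_iff_isUnit_det _).1 hR
  have hdet' : IsUnit Rᵀ.det := by rwa [det_transpose]
  have hC : (R⁻¹ * B * R⁻¹ᵀ).PosDef := by
    rw [← conjTranspose_eq_transpose_of_trivial]
    exact hB.mul_mul_conjTranspose_same
      (Matrix.vecMul_injective_of_isUnit ((Matrix.isUnit_nonsing_inv_iff).2 hR))
  obtain ⟨O, h, h1, h2, h3⟩ := exists_orthogonal_exp hC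
  refine ⟨R * O, h, hR.mul (IsUnit.of_mul_eq_one _ h1), ?_, ?_⟩
  · rw [transpose_mul, Matrix.mul_assoc, ← Matrix.mul_assoc O, h1, Matrix.one_mul]
  · have : R * (O * diagonal (fun x => Real.exp (h x)) * Oᵀ) * Rᵀ = B := by
      rw [← h3, transpose_nonsing_inv]
      simp only [← Matrix.mul_assoc]
      rw [Matrix.mul_nonsing_inv _ hdet, Matrix.one_mul, Matrix.mul_assoc,
        Matrix.nonsing_inv_mul _ hdet', Matrix.mul_one]
    rw [← this, transpose_mul]
    simp only [Matrix.mul_assoc]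

theorem trace_mul_nonneg {A C : Matrix n n ℝ} (hA : A.PosSemidef) (hC : C.PosSemidef) :
    0 ≤ (A * C).trace := by
  obtain ⟨O, a, h1, h2, h3⟩ := exists_orthogonal_diagonal hA.isHermitian
  have hD : diagonal a = Oᵀ * A * O := by
    rw [h3, ← Matrix.mul_assoc, ← Matrix.mul_assoc, h2, Matrix.one_mul, Matrix.mul_assoc, h2,
      Matrix.mul_one]
  have hpos : (diagonal a).PosSemidef := by
    rw [hD, ← conjTranspose_eq_transpose_of_trivial]
    exact hA.conjTranspose_mul_mul_same _
  rw [posSemidef_diagonal_iff] at hpos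
  have hC' : (Oᵀ * C * O).PosSemidef := by
    rw [← conjTranspose_eq_transpose_of_trivial]
    exact hC.conjTranspose_mul_mul_same _
  rw [h3, Matrix.mul_assoc, Matrix.trace_mul_cycle, Matrix.trace_mul_comm]
  simp only [trace, diag_apply, diagonal_mul]
  exact Finset.sum_nonneg fun i _ => mul_nonneg (hpos i) hC'.diag_nonneg

theorem trace_mul_le_trace_mul {A A' C : Matrix n n ℝ} (hA : (A' - A).PosSemidef)
    (hC : C.PosSemidef) : (A * C).trace ≤ (A' * C).trace := by
  have := trace_mul_nonneg hA hC
  rw [Matrix.sub_mul, trace_sub] at this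
  linarith

theorem det_mul_diagonal_exp_mul_transpose (N : Matrix n n ℝ) (h : n → ℝ) :
    (N * diagonal (fun x => Real.exp (h x)) * Nᵀ).det = (N * Nᵀ).det * Real.exp (∑ x, h x) := by
  rw [det_mul, det_mul, det_mul, det_diagonal, Real.exp_sum]
  ring

theorem trace_inv_mul_diagonal_exp {N : Matrix n n ℝ} (hN : IsUnit N) (h : n → ℝ) :
    ((N * Nᵀ)⁻¹ * (N * diagonal (fun x => Real.exp (h x)) * Nᵀ)).trace =
      ∑ x, Real.exp (h x) := by
  have hdet : IsUnit N.det := (Matrix.isUnit_iff_isUnit_det _).1 hN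
  have hdet' : IsUnit Nᵀ.det := by rwa [det_transpose]
  rw [Matrix.mul_inv_rev, Matrix.mul_assoc, Matrix.mul_assoc N, ← Matrix.mul_assoc N⁻¹,
    Matrix.nonsing_inv_mul _ hdet, Matrix.one_mul, Matrix.trace_mul_comm, Matrix.mul_assoc,
    Matrix.mul_nonsing_inv _ hdet', Matrix.mul_one, trace_diagonal]

/-- The weak duality inequality between `log det` and its concave conjugate. -/
theorem log_det_add_log_det_le {A C : Matrix n n ℝ} (hA : A.PosDef) (hC : C.PosDef) :
    Real.log A.det + Real.log C.det ≤ (C * A).trace - Fintype.card n := by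
  -- In a frame that diagonalises `C⁻¹` and `A` the claim is `∑ h ≤ ∑ (exp h - 1)`.
  obtain ⟨N, h, hN, h1, h2⟩ := exists_simultaneous_diagonalization hC.inv hA
  have hCC : C = (N * Nᵀ)⁻¹ := by
    rw [← h1, Matrix.nonsing_inv_nonsing_inv _ hC.det_pos.ne'.isUnit]
  have hlog : Real.log A.det = Real.log (N * Nᵀ).det + ∑ x, h x := by
    rw [h2, det_mul_diagonal_exp_mul_transpose, Real.log_mul _ (Real.exp_pos _).ne', Real.log_exp]
    rw [← h1]
    exact hC.inv.det_pos.ne'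
  have htr : (C * A).trace = ∑ x, Real.exp (h x) := by
    rw [hCC, h2, trace_inv_mul_diagonal_exp hN]
  have hlogC : Real.log (N * Nᵀ).det = - Real.log C.det := by
    rw [← h1, det_nonsing_inv, Ring.inverse_eq_inv', Real.log_inv]
  rw [hlog, htr, hlogC]
  have : ∑ x, h x ≤ ∑ x, (Real.exp (h x) - 1) :=
    Finset.sum_le_sum fun x _ => by linarith [Real.add_one_le_exp (h x)]
  rw [Finset.sum_sub_distrib] at this
  simp at this
  linarith

/-- Monotonicity of the determinant, from the weak duality inequality with `C = A'⁻¹`. -/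
theorem det_le_det_of_posSemidef_sub {A A' : Matrix n n ℝ} (hA : A.PosSemidef)
    (h : (A' - A).PosSemidef) : A.det ≤ A'.det := by
  have hA' : A'.PosSemidef := by simpa using hA.add h
  by_cases h0 : A.det = 0
  · rw [h0]; exact hA'.det_nonneg
  have hAp : A.PosDef := hA.posDef_iff_det_ne_zero.2 h0
  have hAp' : A'.PosDef := by simpa using hAp.add_posSemidef h
  have h1 := log_det_add_log_det_le hAp hAp'.inv
  have h2 := trace_mul_le_trace_mul h hAp'.inv.posSemidef
  rw [Matrix.mul_nonsing_inv _ hAp'.det_pos.ne'.isUnit, trace_one, Matrix.trace_mul_comm] at h2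
  rw [det_nonsing_inv, Ring.inverse_eq_inv', Real.log_inv] at h1
  exact (Real.log_le_log_iff hAp.det_pos hAp'.det_pos).1 (by linarith)

theorem abs_apply_le_of_posSemidef {m : Type*} [Fintype m] [DecidableEq m] {S : Matrix m m ℝ}
    (hS : S.PosSemidef) (a b : m) : |S a b| ≤ S a a + S b b := by
  have hsymm : S b a = S a b := by
    simpa using hS.isHermitian.apply a b
  have h0 := hS.diag_nonneg (i := a)
  have h1 := hS.diag_nonneg (i := b)
  have hp := hS.dotProduct_mulVec_nonneg (Pi.single a 1 + Pi.single b 1)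
  have hm := hS.dotProduct_mulVec_nonneg (Pi.single a 1 - Pi.single b 1)
  simp [Matrix.mulVec_add, Matrix.mulVec_sub, add_dotProduct, sub_dotProduct] at hp hm
  rw [abs_le]
  constructor <;> linarith

theorem isClosed_posSemidef {m : Type*} [Fintype m] :
    IsClosed {S : Matrix m m ℝ | S.PosSemidef} := by
  have : {S : Matrix m m ℝ | S.PosSemidef} =
      {S | Sᴴ = S} ∩ ⋂ x : m → ℝ, {S | 0 ≤ star x ⬝ᵥ (S *ᵥ x)} := by
    ext S
    simp [posSemidef_iff_dotProduct_mulVec, IsHermitian]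
  rw [this]
  refine (isClosed_eq (by fun_prop) (by fun_prop)).inter (isClosed_iInter fun x => ?_)
  exact isClosed_le continuous_const (by fun_prop)

theorem posSemidef_mul_mul_transpose {m p : Type*} [Fintype m] [Fintype p] {S : Matrix m m ℝ}
    (hS : S.PosSemidef) (B : Matrix p m ℝ) : (B * S * Bᵀ).PosSemidef := by
  rw [← conjTranspose_eq_transpose_of_trivial]
  exact hS.mul_mul_conjTranspose_same B

theorem posDef_mul_mul_transpose {m p : Type*} [Fintype m] [Fintype p] {S : Matrix m m ℝ}
    (hS : S.PosDef) {B : Matrix p m ℝ} (hB : Function.Injective B.vecMul) :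
    (B * S * Bᵀ).PosDef := by
  rw [← conjTranspose_eq_transpose_of_trivial]
  exact hS.mul_mul_conjTranspose_same hB

end MatrixBasics

/-! ### Couplings of block matrices and the determinant product -/

section Couplings

variable {ι κ : Type*} [Fintype ι] [DecidableEq ι] [Fintype κ]
  {n : ι → Type*} [∀ i, Fintype (n i)] [∀ i, DecidableEq (n i)]
  {n' : κ → Type*} [∀ j, Fintype (n' j)] [∀ j, DecidableEq (n' j)]

/-- The positive semidefinite block matrices with prescribed diagonal blocks. -/
def gramCouplings (K : ∀ i, Matrix (n i) (n i) ℝ) : Set (Matrix (Σ i, n i) (Σ i, n i) ℝ) :=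
  {S | S.PosSemidef ∧ ∀ i, blockDiag' S i = K i}

/-- `∏ⱼ det (Bⱼ S Bⱼᵀ) ^ dⱼ`, the exponential of `∑ⱼ dⱼ log det (Bⱼ S Bⱼᵀ)`. It is real valued and
continuous in `S` also where the sum of logarithms is `-∞`. -/
noncomputable def detProd (d : κ → ℝ) (B : ∀ j, Matrix (n' j) (Σ i, n i) ℝ)
    (S : Matrix (Σ i, n i) (Σ i, n i) ℝ) : ℝ :=
  ∏ j, (B j * S * (B j)ᵀ).det ^ d j

theorem posDef_blockDiagonal' {K : ∀ i, Matrix (n i) (n i) ℝ} (hK : ∀ i, (K i).PosDef) :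
    (blockDiagonal' K).PosDef := by
  choose R hR hKR using fun i => exists_isUnit_mul_transpose (hK i)
  have h1 : blockDiagonal' K = blockDiagonal' R * 1 * (blockDiagonal' R)ᴴ := by
    rw [conjTranspose_eq_transpose_of_trivial, blockDiagonal'_transpose, Matrix.mul_one,
      ← blockDiagonal'_mul]
    exact congrArg _ (funext hKR)
  rw [h1]
  refine PosDef.one.mul_mul_conjTranspose_same (Matrix.vecMul_injective_of_isUnit ?_)
  refine IsUnit.of_mul_eq_one (blockDiagonal' fun i => (R i)⁻¹) ?_
  rw [← blockDiagonal'_mul, ← blockDiagonal'_one]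
  congr 1
  ext1 i
  exact Matrix.mul_nonsing_inv _ ((Matrix.isUnit_iff_isUnit_det _).1 (hR i))

theorem blockDiagonal'_mem_gramCouplings {K : ∀ i, Matrix (n i) (n i) ℝ}
    (hK : ∀ i, (K i).PosDef) : blockDiagonal' K ∈ gramCouplings K :=
  ⟨(posDef_blockDiagonal' hK).posSemidef, fun i => by rw [blockDiag'_blockDiagonal']⟩

theorem trace_blockDiagonal'_mul (U : ∀ i, Matrix (n i) (n i) ℝ)
    (S : Matrix (Σ i, n i) (Σ i, n i) ℝ) :
    (blockDiagonal' U * S).trace = ∑ i, (U i * blockDiag' S i).trace := by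
  simp only [trace, diag_apply, Matrix.mul_apply, Fintype.sum_sigma, blockDiagonal'_apply]
  refine Finset.sum_congr rfl fun i _ => Finset.sum_congr rfl fun a _ => ?_
  rw [Finset.sum_eq_single i]
  · simp [blockDiag'_apply]
  · intro i' _ hi
    simp [Ne.symm hi]
  · simp

theorem isCompact_gramCouplings (K : ∀ i, Matrix (n i) (n i) ℝ) :
    IsCompact (gramCouplings K) := by
  have hc : IsCompact (Set.univ.pi fun a : Σ i, n i => Set.univ.pi fun b : Σ i, n i =>
      Set.Icc (-(K a.1 a.2 a.2 + K b.1 b.2 b.2)) (K a.1 a.2 a.2 + K b.1 b.2 b.2)) :=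
    isCompact_univ_pi fun a => isCompact_univ_pi fun b => isCompact_Icc
  refine hc.of_isClosed_subset (t := gramCouplings K) ?_ ?_
  · have : gramCouplings K = {S | S.PosSemidef} ∩ ⋂ i, {S | blockDiag' S i = K i} := by
      ext S
      simp [gramCouplings]
    rw [this]
    refine isClosed_posSemidef.inter (isClosed_iInter fun i => isClosed_eq ?_ continuous_const)
    exact (continuous_apply i).comp (Continuous.matrix_blockDiag' continuous_id)
  · rintro S ⟨hS, hSK⟩ a - b -
    have h := abs_apply_le_of_posSemidef hS a b
    have haa : S a a = K a.1 a.2 a.2 := by rw [← hSK]; rfl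
    have hbb : S b b = K b.1 b.2 b.2 := by rw [← hSK]; rfl
    rw [haa, hbb, abs_le] at h
    exact h

theorem continuous_detProd {d : κ → ℝ} (hd : ∀ j, 0 < d j)
    (B : ∀ j, Matrix (n' j) (Σ i, n i) ℝ) : Continuous (detProd d B) := by
  refine continuous_finsetProd _ fun j _ => Continuous.rpow_const ?_ fun _ => Or.inr (hd j).le
  exact Continuous.matrix_det (by fun_prop)

theorem detProd_nonneg (d : κ → ℝ) (B : ∀ j, Matrix (n' j) (Σ i, n i) ℝ)
    {S : Matrix (Σ i, n i) (Σ i, n i) ℝ} (hS : S.PosSemidef) : 0 ≤ detProd d B S :=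
  Finset.prod_nonneg fun j _ =>
    Real.rpow_nonneg (posSemidef_mul_mul_transpose hS (B j)).det_nonneg _

theorem detProd_pos (d : κ → ℝ) {B : ∀ j, Matrix (n' j) (Σ i, n i) ℝ}
    (hB : ∀ j, Function.Injective (B j).vecMul)
    {S : Matrix (Σ i, n i) (Σ i, n i) ℝ} (hS : S.PosDef) : 0 < detProd d B S :=
  Finset.prod_pos fun j _ => Real.rpow_pos_of_pos (posDef_mul_mul_transpose hS (hB j)).det_pos _

theorem log_detProd {d : κ → ℝ} {B : ∀ j, Matrix (n' j) (Σ i, n i) ℝ}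
    {S : Matrix (Σ i, n i) (Σ i, n i) ℝ} (h : ∀ j, (B j * S * (B j)ᵀ).PosDef) :
    Real.log (detProd d B S) = ∑ j, d j * Real.log (B j * S * (B j)ᵀ).det := by
  rw [detProd, Real.log_prod fun j _ => (Real.rpow_pos_of_pos (h j).det_pos _).ne']
  exact Finset.sum_congr rfl fun j _ => Real.log_rpow (h j).det_pos _

/-- If some `Bⱼ` is not surjective, then `Bⱼ S Bⱼᵀ` is singular for every `S`. -/
theorem detProd_eq_zero {d : κ → ℝ} (hd : ∀ j, 0 < d j) {B : ∀ j, Matrix (n' j) (Σ i, n i) ℝ}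
    {j : κ} (hB : ¬ Function.Injective (B j).vecMul)
    (S : Matrix (Σ i, n i) (Σ i, n i) ℝ) : detProd d B S = 0 := by
  refine Finset.prod_eq_zero (Finset.mem_univ j) ?_
  have h : (B j * S * (B j)ᵀ).det = 0 := by
    simp only [Function.Injective, not_forall] at hB
    obtain ⟨v, w, hvw, hne⟩ := hB
    refine exists_vecMul_eq_zero_iff.1 ⟨v - w, sub_ne_zero.2 hne, ?_⟩
    rw [Matrix.mul_assoc, ← vecMul_vecMul, sub_vecMul]
    have : v ᵥ* B j = w ᵥ* B j := hvw
    rw [this, sub_self, zero_vecMul]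
  rw [h, Real.zero_rpow (hd j).ne']

/-- Enlarging the marginals enlarges the maximum of `detProd`, up to the homogeneity factor. -/
theorem exists_gramCouplings_rpow_mul_detProd_le {d : κ → ℝ} (hd : ∀ j, 0 < d j)
    (B : ∀ j, Matrix (n' j) (Σ i, n i) ℝ) {K L : ∀ i, Matrix (n i) (n i) ℝ} {r : ℝ} (hr : 0 < r)
    (hKL : ∀ i, (K i - r • L i).PosDef) {S : Matrix (Σ i, n i) (Σ i, n i) ℝ}
    (hS : S ∈ gramCouplings L) :
    ∃ S' ∈ gramCouplings K,
      r ^ (∑ j, d j * Fintype.card (n' j)) * detProd d B S ≤ detProd d B S' := by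
  have hD := (posDef_blockDiagonal' hKL).posSemidef
  have hrS : (r • S).PosSemidef := hS.1.smul hr.le
  -- The witness is `r S` plus the block diagonal of the excess of the marginals.
  refine ⟨r • S + blockDiagonal' fun i => K i - r • L i, ⟨hrS.add hD, fun i => ?_⟩, ?_⟩
  · rw [blockDiag'_add, Pi.add_apply, blockDiag'_blockDiagonal', blockDiag'_smul, Pi.smul_apply,
      hS.2 i]
    abel
  · rw [Real.rpow_sum_of_pos hr, detProd, ← Finset.prod_mul_distrib]
    refine Finset.prod_le_prod (fun j _ => ?_) fun j _ => ?_
    · exact mul_nonneg (Real.rpow_nonneg hr.le _)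
        (Real.rpow_nonneg (posSemidef_mul_mul_transpose hS.1 (B j)).det_nonneg _)
    · rw [mul_comm (d j), Real.rpow_mul hr.le, Real.rpow_natCast,
        ← Real.mul_rpow (by positivity) (posSemidef_mul_mul_transpose hS.1 (B j)).det_nonneg,
        ← det_smul]
      refine Real.rpow_le_rpow ?_ (det_le_det_of_posSemidef_sub ?_ ?_) (hd j).le
      · exact ((posSemidef_mul_mul_transpose hS.1 (B j)).smul hr.le).det_nonneg
      · exact (posSemidef_mul_mul_transpose hS.1 (B j)).smul hr.le
      · have : B j * (r • S + blockDiagonal' fun i => K i - r • L i) * (B j)ᵀ -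
            r • (B j * S * (B j)ᵀ) =
            B j * (blockDiagonal' fun i => K i - r • L i) * (B j)ᵀ := by
          rw [Matrix.mul_add, Matrix.add_mul, Matrix.mul_smul, Matrix.smul_mul, add_sub_cancel_left]
        rw [this]
        exact posSemidef_mul_mul_transpose hD (B j)

end Couplings

/-! ### Dual certificates from the regularised maximisation problem -/

section OpenCone

variable {m : Type*} [Fintype m] [DecidableEq m]

/-- Positive definiteness is an open condition among symmetric matrices. -/
theorem eventually_posDef {A : Matrix m m ℝ} (hA : A.PosDef) :
    ∀ᶠ A' in 𝓝 A, A'.IsHermitian → A'.PosDef := by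
  have hc : IsCompact (Metric.sphere (0 : m → ℝ) 1) := isCompact_sphere _ _
  have key : ∀ᶠ A' in 𝓝 A, ∀ x ∈ Metric.sphere (0 : m → ℝ) 1, 0 < x ⬝ᵥ (A' *ᵥ x) := by
    refine hc.eventually_forall_of_forall_eventually fun x hx => ?_
    have hx0 : x ≠ 0 := by
      rintro rfl
      simp at hx
    have h0 : 0 < x ⬝ᵥ (A *ᵥ x) := by
      simpa using hA.dotProduct_mulVec_pos hx0
    have hcont : Continuous fun z : Matrix m m ℝ × (m → ℝ) => z.2 ⬝ᵥ (z.1 *ᵥ z.2) := by fun_prop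
    exact hcont.continuousAt.eventually (lt_mem_nhds h0)
  filter_upwards [key] with A' h hA'
  refine PosDef.of_dotProduct_mulVec_pos hA' fun x hx => ?_
  have hn : 0 < ‖x‖ := norm_pos_iff.2 hx
  have h1 := h (‖x‖⁻¹ • x) (by
    rw [mem_sphere_zero_iff_norm, norm_smul, norm_inv, norm_norm, inv_mul_cancel₀ hn.ne'])
  rw [mulVec_smul, dotProduct_smul, smul_dotProduct, smul_eq_mul, smul_eq_mul,
    ← mul_assoc] at h1
  simpa using (pos_iff_pos_of_mul_pos h1).1 (by positivity)

theorem continuousAt_matrix_inv {A : Matrix m m ℝ} (hA : A.det ≠ 0) :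
    ContinuousAt (fun A : Matrix m m ℝ => A⁻¹) A := by
  simp only [Matrix.inv_def, Ring.inverse_eq_inv']
  exact ContinuousAt.smul ((Continuous.matrix_det continuous_id).continuousAt.inv₀ hA)
    (Continuous.matrix_adjugate continuous_id).continuousAt

/-- Concavity of `log det`, with the gradient evaluated at the far end point `A + s X`. -/
theorem log_det_sub_log_det_le {A X : Matrix m m ℝ} {s : ℝ} (hA : A.PosDef)
    (hAX : (A + s • X).PosDef) :
    Real.log A.det - Real.log (A + s • X).det ≤ -(s * ((A + s • X)⁻¹ * X).trace) := by
  have h := log_det_add_log_det_le hA hAX.inv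
  have h2 : (A + s • X)⁻¹ * A = 1 - s • ((A + s • X)⁻¹ * X) := by
    have : A = (A + s • X) - s • X := by abel
    nth_rewrite 2 [this]
    rw [Matrix.mul_sub, Matrix.nonsing_inv_mul _ hAX.det_pos.ne'.isUnit, Matrix.mul_smul]
  rw [h2, trace_sub, trace_one, trace_smul, det_nonsing_inv, Ring.inverse_eq_inv',
    Real.log_inv, smul_eq_mul] at h
  linarith

end OpenCone

section Certificate

variable {ι κ : Type*} [Fintype ι] [DecidableEq ι] [Fintype κ]
  {n : ι → Type*} [∀ i, Fintype (n i)] [∀ i, DecidableEq (n i)]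
  {n' : κ → Type*} [∀ j, Fintype (n' j)] [∀ j, DecidableEq (n' j)]

/-- The gradient at `S` of `∑ⱼ dⱼ log det (Bⱼ S Bⱼᵀ) + ε log det S`. -/
noncomputable def regularizedGradient (d : κ → ℝ) (B : ∀ j, Matrix (n' j) (Σ i, n i) ℝ) (ε : ℝ)
    (S : Matrix (Σ i, n i) (Σ i, n i) ℝ) : Matrix (Σ i, n i) (Σ i, n i) ℝ :=
  ∑ j, d j • ((B j)ᵀ * (B j * S * (B j)ᵀ)⁻¹ * B j) + ε • S⁻¹

theorem trace_regularizedGradient_mul (d : κ → ℝ) (B : ∀ j, Matrix (n' j) (Σ i, n i) ℝ) (ε : ℝ)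
    (S X : Matrix (Σ i, n i) (Σ i, n i) ℝ) :
    (regularizedGradient d B ε S * X).trace =
      ∑ j, d j * ((B j * S * (B j)ᵀ)⁻¹ * (B j * X * (B j)ᵀ)).trace + ε * (S⁻¹ * X).trace := by
  rw [regularizedGradient, Matrix.add_mul, trace_add, Matrix.sum_mul, trace_sum]
  congr 1
  · refine Finset.sum_congr rfl fun j _ => ?_
    rw [Matrix.smul_mul, trace_smul, smul_eq_mul]
    congr 1
    simp only [Matrix.mul_assoc]
    rw [Matrix.trace_mul_comm]
    simp only [Matrix.mul_assoc]
  · rw [Matrix.smul_mul, trace_smul, smul_eq_mul]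

theorem posDef_regularizedGradient {d : κ → ℝ} (hd : ∀ j, 0 < d j)
    (B : ∀ j, Matrix (n' j) (Σ i, n i) ℝ) {ε : ℝ} (hε : 0 < ε)
    {S : Matrix (Σ i, n i) (Σ i, n i) ℝ} (hS : S.PosDef) :
    (regularizedGradient d B ε S).PosDef := by
  refine PosDef.posSemidef_add (posSemidef_sum _ fun j _ => PosSemidef.smul ?_ (hd j).le)
    (hS.inv.smul hε)
  have := posSemidef_mul_mul_transpose (posSemidef_mul_mul_transpose hS.posSemidef (B j)).inv (B j)ᵀ
  rwa [transpose_transpose] at this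

/-- First order optimality of a maximiser of `detProd d B S * det S ^ ε` among the couplings: the
directional derivative is nonpositive in every direction that keeps the diagonal blocks. -/
theorem trace_regularizedGradient_mul_nonpos {d : κ → ℝ} (hd : ∀ j, 0 < d j)
    {B : ∀ j, Matrix (n' j) (Σ i, n i) ℝ} (hB : ∀ j, Function.Injective (B j).vecMul)
    {ε : ℝ} (hε : 0 < ε) {K : ∀ i, Matrix (n i) (n i) ℝ}
    {S : Matrix (Σ i, n i) (Σ i, n i) ℝ} (hS : S.PosDef) (hSK : S ∈ gramCouplings K)
    (hmax : ∀ S' ∈ gramCouplings K, detProd d B S' * S'.det ^ ε ≤ detProd d B S * S.det ^ ε)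
    {X : Matrix (Σ i, n i) (Σ i, n i) ℝ} (hX : X.IsHermitian) (hX0 : ∀ i, blockDiag' X i = 0) :
    (regularizedGradient d B ε S * X).trace ≤ 0 := by
  have hline : Continuous fun s : ℝ => S + s • X := by fun_prop
  have hline0 : S + (0 : ℝ) • X = S := by simp
  have hpd : ∀ᶠ s in 𝓝[>] (0 : ℝ), (S + s • X).PosDef := by
    refine nhdsWithin_le_nhds ?_
    have h := hline.continuousAt (x := 0)
    rw [ContinuousAt, hline0] at h
    filter_upwards [h.eventually (eventually_posDef hS)] with s hs
    exact hs (hS.isHermitian.add (by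
      rw [IsHermitian, conjTranspose_smul, hX.eq]
      simp))
  -- `g s` is the derivative along the segment at `S + s X`. By concavity and maximality it is
  -- nonpositive for small `s > 0`, and `s → 0` gives the claim.
  set g : ℝ → ℝ := fun s =>
    ∑ j, d j * ((B j * (S + s • X) * (B j)ᵀ)⁻¹ * (B j * X * (B j)ᵀ)).trace +
      ε * ((S + s • X)⁻¹ * X).trace with hg
  have hg0 : g 0 = (regularizedGradient d B ε S * X).trace := by
    rw [trace_regularizedGradient_mul]
    simp only [hg, hline0]
  have hgc : ContinuousAt g 0 := by
    refine ContinuousAt.add (tendsto_finsetSum _ fun j _ => ?_) ?_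
    · refine ContinuousAt.mul continuousAt_const ?_
      refine (Continuous.matrix_trace continuous_id).continuousAt.comp ?_
      refine ContinuousAt.mul (f := fun s : ℝ => (B j * (S + s • X) * (B j)ᵀ)⁻¹) ?_
        continuousAt_const
      refine ContinuousAt.comp (g := fun A : Matrix (n' j) (n' j) ℝ => A⁻¹)
        (f := fun s : ℝ => B j * (S + s • X) * (B j)ᵀ) (continuousAt_matrix_inv ?_)
        (by fun_prop)
      rw [hline0]
      exact (posDef_mul_mul_transpose hS (hB j)).det_pos.ne'
    · refine ContinuousAt.mul continuousAt_const ?_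
      refine (Continuous.matrix_trace continuous_id).continuousAt.comp ?_
      refine ContinuousAt.mul (f := fun s : ℝ => (S + s • X)⁻¹) ?_ continuousAt_const
      refine ContinuousAt.comp (g := fun A : Matrix (Σ i, n i) (Σ i, n i) ℝ => A⁻¹)
        (f := fun s : ℝ => S + s • X) (continuousAt_matrix_inv ?_) (by fun_prop)
      rw [hline0]
      exact hS.det_pos.ne'
  rw [← hg0]
  refine le_of_tendsto (hgc.tendsto.mono_left (nhdsWithin_le_nhds (s := Set.Ioi 0))) ?_
  filter_upwards [hpd, self_mem_nhdsWithin] with s hs hs0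
  have hs0 : 0 < s := hs0
  have hmem : S + s • X ∈ gramCouplings K := ⟨hs.posSemidef, fun i => by
    rw [blockDiag'_add, Pi.add_apply, blockDiag'_smul, Pi.smul_apply, hX0 i, hSK.2 i]
    simp⟩
  have h1 := Real.log_le_log (mul_pos (detProd_pos d hB hs) (Real.rpow_pos_of_pos hs.det_pos ε))
    (hmax _ hmem)
  rw [Real.log_mul (detProd_pos d hB hs).ne' (Real.rpow_pos_of_pos hs.det_pos ε).ne',
    Real.log_mul (detProd_pos d hB hS).ne' (Real.rpow_pos_of_pos hS.det_pos ε).ne',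
    Real.log_rpow hs.det_pos, Real.log_rpow hS.det_pos,
    log_detProd fun j => posDef_mul_mul_transpose hs (hB j),
    log_detProd fun j => posDef_mul_mul_transpose hS (hB j)] at h1
  have h2 : ∑ j, d j * (Real.log (B j * S * (B j)ᵀ).det -
        Real.log (B j * (S + s • X) * (B j)ᵀ).det) ≤
      ∑ j, d j * -(s * ((B j * (S + s • X) * (B j)ᵀ)⁻¹ * (B j * X * (B j)ᵀ)).trace) := by
    refine Finset.sum_le_sum fun j _ => mul_le_mul_of_nonneg_left ?_ (hd j).le
    have h3 : B j * (S + s • X) * (B j)ᵀ = B j * S * (B j)ᵀ + s • (B j * X * (B j)ᵀ) := by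
      rw [Matrix.mul_add, Matrix.add_mul, Matrix.mul_smul, Matrix.smul_mul]
    have h4 := posDef_mul_mul_transpose hs (hB j)
    rw [h3] at h4 ⊢
    exact log_det_sub_log_det_le (posDef_mul_mul_transpose hS (hB j)) h4
  have h5 := mul_le_mul_of_nonneg_left (log_det_sub_log_det_le hS hs) hε.le
  have h6 : ∑ j, d j * -(s * ((B j * (S + s • X) * (B j)ᵀ)⁻¹ * (B j * X * (B j)ᵀ)).trace) +
      ε * -(s * ((S + s • X)⁻¹ * X).trace) = -(s * g s) := by
    simp only [hg]
    rw [mul_add, Finset.mul_sum, neg_add, ← Finset.sum_neg_distrib]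
    congr 1
    · exact Finset.sum_congr rfl fun j _ => by ring
    · ring
  simp only [mul_sub, Finset.sum_sub_distrib] at h2
  have h7 : 0 ≤ -(s * g s) := by linarith
  by_contra hcon
  have := mul_pos hs0 (not_le.1 hcon)
  linarith

/-- Approximate dual certificates. The gradient at the maximiser of the `ε`-regularised problem is
block diagonal, because it is orthogonal to the symmetric matrices with vanishing diagonal blocks,
and its blocks `Uᵢ` are Lagrange multipliers of the constraints on the marginals. -/
theorem exists_dual_certificate {d : κ → ℝ} (hd : ∀ j, 0 < d j)
    {B : ∀ j, Matrix (n' j) (Σ i, n i) ℝ} (hB : ∀ j, Function.Injective (B j).vecMul)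
    {ε : ℝ} (hε : 0 < ε) {K : ∀ i, Matrix (n i) (n i) ℝ} (hK : ∀ i, (K i).PosDef) :
    ∃ S ∈ gramCouplings K, S.PosDef ∧ ∃ U : ∀ i, Matrix (n i) (n i) ℝ, (∀ i, (U i).PosDef) ∧
      (blockDiagonal' U - ∑ j, d j • ((B j)ᵀ * (B j * S * (B j)ᵀ)⁻¹ * B j)).PosSemidef ∧
      ∑ i, (U i * K i).trace =
        ∑ j, d j * Fintype.card (n' j) + ε * Fintype.card (Σ i, n i) := by
  obtain ⟨S, hSK, hmax⟩ := (isCompact_gramCouplings K).exists_isMaxOn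
    ⟨_, blockDiagonal'_mem_gramCouplings hK⟩
    (f := fun S => detProd d B S * S.det ^ ε)
    ((continuous_detProd hd B).mul (Continuous.rpow_const (Continuous.matrix_det continuous_id)
      fun _ => Or.inr hε.le)).continuousOn
  have hS : S.PosDef := by
    refine hSK.1.posDef_iff_det_ne_zero.2 fun h0 => ?_
    have h1 : detProd d B (blockDiagonal' K) * (blockDiagonal' K).det ^ ε ≤
      detProd d B S * S.det ^ ε := hmax (blockDiagonal'_mem_gramCouplings hK)
    rw [h0, Real.zero_rpow hε.ne', mul_zero] at h1
    have hKd := posDef_blockDiagonal' hK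
    exact absurd (mul_pos (detProd_pos d hB hKd) (Real.rpow_pos_of_pos hKd.det_pos ε)) h1.not_gt
  set G := regularizedGradient d B ε S with hG
  have hGpd : G.PosDef := posDef_regularizedGradient hd B hε hS
  -- Testing the optimality with the off-diagonal part `X` of `G` itself gives `tr (Xᵀ X) ≤ 0`.
  set X := G - blockDiagonal' (blockDiag' G) with hXdef
  have hX0 : ∀ i, blockDiag' X i = 0 := fun i => by
    rw [hXdef, blockDiag'_sub, blockDiag'_blockDiagonal', sub_self, Pi.zero_apply]
  have hXh : X.IsHermitian := by
    rw [IsHermitian, hXdef, conjTranspose_sub, blockDiagonal'_conjTranspose, hGpd.isHermitian.eq]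
    congr 2
    funext i
    rw [← blockDiag'_conjTranspose, hGpd.isHermitian.eq]
  have htr : (G * X).trace ≤ 0 :=
    trace_regularizedGradient_mul_nonpos hd hB hε hS hSK hmax hXh hX0
  have hXX : (Xᴴ * X).trace = (G * X).trace := by
    have : G = X + blockDiagonal' (blockDiag' G) := by simp [hXdef]
    nth_rewrite 1 [this]
    rw [hXh.eq, Matrix.add_mul, trace_add, trace_blockDiagonal'_mul]
    simp [hX0]
  have hXz : X = 0 := by
    refine trace_conjTranspose_mul_self_eq_zero_iff.1 (le_antisymm (hXX ▸ htr) ?_)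
    exact (posSemidef_conjTranspose_mul_self X).trace_nonneg
  have hGU : blockDiagonal' (blockDiag' G) = G := (sub_eq_zero.1 hXz).symm
  refine ⟨S, hSK, hS, blockDiag' G, fun i => ?_, ?_, ?_⟩
  · exact hGpd.submatrix (e := Sigma.mk i) sigma_mk_injective
  · rw [hGU, hG, regularizedGradient, add_sub_cancel_left]
    exact (hS.inv.smul hε).posSemidef
  · have h1 : ∑ i, (blockDiag' G i * K i).trace = (G * S).trace := by
      nth_rewrite 2 [← hGU]
      rw [trace_blockDiagonal'_mul]
      simp only [hSK.2]
    rw [h1, hG, trace_regularizedGradient_mul, Matrix.nonsing_inv_mul _ hS.det_pos.ne'.isUnit,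
      trace_one]
    congr 1
    refine Finset.sum_congr rfl fun j _ => ?_
    rw [Matrix.nonsing_inv_mul _ (posDef_mul_mul_transpose hS (hB j)).det_pos.ne'.isUnit, trace_one]

end Certificate

/-! ### Interpolation of operator inequalities along geodesics -/

section ThreeLines

variable {p q : Type*} [Fintype p] [Fintype q]

/-- The bilinear form of a real contraction, extended to complex vectors. -/
theorem norm_sum_mul_le_of_contraction {T : Matrix q p ℝ}
    (hT : ∀ w : p → ℝ, ∑ a, (T *ᵥ w) a ^ 2 ≤ ∑ b, w b ^ 2) (y : q → ℂ) (x : p → ℂ) :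
    ‖∑ a, ∑ b, y a * T a b * x b‖ ≤ (∑ a, ‖y a‖ ^ 2 + ∑ b, ‖x b‖ ^ 2) / 2 := by
  have hre : ∀ a, (∑ b, (T a b : ℂ) * x b).re = (T *ᵥ fun b => (x b).re) a := fun a => by
    simp [mulVec, dotProduct]
  have him : ∀ a, (∑ b, (T a b : ℂ) * x b).im = (T *ᵥ fun b => (x b).im) a := fun a => by
    simp [mulVec, dotProduct]
  have hnorm : ∀ z : ℂ, ‖z‖ ^ 2 = z.re ^ 2 + z.im ^ 2 := fun z => by
    rw [Complex.sq_norm, Complex.normSq_apply]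
    ring
  have h1 : ∑ a, ‖∑ b, (T a b : ℂ) * x b‖ ^ 2 ≤ ∑ b, ‖x b‖ ^ 2 := by
    simp only [hnorm, hre, him, Finset.sum_add_distrib]
    exact add_le_add (hT _) (hT _)
  calc ‖∑ a, ∑ b, y a * T a b * x b‖ = ‖∑ a, y a * ∑ b, (T a b : ℂ) * x b‖ := by
        simp only [Finset.mul_sum, mul_assoc]
    _ ≤ ∑ a, ‖y a‖ * ‖∑ b, (T a b : ℂ) * x b‖ := by
        refine (norm_sum_le _ _).trans (Finset.sum_le_sum fun a _ => (norm_mul _ _).le)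
    _ ≤ ∑ a, (‖y a‖ ^ 2 + ‖∑ b, (T a b : ℂ) * x b‖ ^ 2) / 2 :=
        Finset.sum_le_sum fun a _ => by
          linarith [two_mul_le_add_sq ‖y a‖ ‖∑ b, (T a b : ℂ) * x b‖]
    _ ≤ _ := by
        rw [← Finset.sum_div, Finset.sum_add_distrib]
        linarith

/-- Interpolation of weighted `ℓ²` bounds: if `M` is a contraction for the weights `e^{t v}`,
`e^{t u}` at `t = 0` and `t = 1`, then it is one for every `t` in between. This is the Hadamard
three lines theorem for `z ↦ ⟨y, e^{z v / 2} M e^{- z u / 2} x⟩`. -/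
theorem sum_exp_mul_sq_le_of_endpoints {M : Matrix q p ℝ} {v : q → ℝ} {u : p → ℝ}
    (h0 : ∀ w : p → ℝ, ∑ a, (M *ᵥ w) a ^ 2 ≤ ∑ b, w b ^ 2)
    (h1 : ∀ w : p → ℝ, ∑ a, Real.exp (v a) * (M *ᵥ w) a ^ 2 ≤ ∑ b, Real.exp (u b) * w b ^ 2)
    {t : ℝ} (ht : t ∈ Set.Icc (0 : ℝ) 1) (w : p → ℝ) :
    ∑ a, Real.exp (t * v a) * (M *ᵥ w) a ^ 2 ≤ ∑ b, Real.exp (t * u b) * w b ^ 2 := by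
  -- With this `x` and `y` the value at `t` is `∑ y² = ⟨y, y⟩`, and the bound `c` on the two
  -- boundary lines turns into `∑ y² ≤ (∑ y² + ∑ x²) / 2`.
  set y : q → ℝ := fun a => Real.exp (t * v a / 2) * (M *ᵥ w) a with hy
  set x : p → ℝ := fun b => Real.exp (t * u b / 2) * w b with hx
  set c : ℝ := (∑ a, y a ^ 2 + ∑ b, x b ^ 2) / 2 with hc
  have hc0 : 0 ≤ c := by positivity
  set f : ℂ → ℂ := fun z => ∑ a, ∑ b,
    (y a * Complex.exp (z * (v a / 2 : ℝ))) * M a b * (x b * Complex.exp (z * (-(u b / 2) : ℝ)))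
    with hf
  have hexp : ∀ (z : ℂ) (s : ℝ), ‖Complex.exp (z * s)‖ = Real.exp (z.re * s) := fun z s => by
    rw [Complex.norm_exp]
    simp
  have hleft : ∀ z ∈ Complex.re ⁻¹' {(0 : ℝ)}, ‖f z‖ ≤ c := by
    intro z hz
    have hz : z.re = 0 := hz
    refine (norm_sum_mul_le_of_contraction h0 _ _).trans (le_of_eq ?_)
    simp only [hc, norm_mul, hexp, hz, zero_mul, Real.exp_zero, mul_one, Complex.norm_real,
      Real.norm_eq_abs, sq_abs]
  have hT : ∀ w : p → ℝ, ∑ a, ((Matrix.of fun a b =>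
      Real.exp (v a / 2) * M a b * Real.exp (-(u b / 2))) *ᵥ w) a ^ 2 ≤ ∑ b, w b ^ 2 := by
    intro w
    have h := h1 fun b => Real.exp (-(u b / 2)) * w b
    refine (le_of_eq ?_).trans (h.trans (le_of_eq ?_))
    · refine Finset.sum_congr rfl fun a _ => ?_
      have : Real.exp (v a) = Real.exp (v a / 2) ^ 2 := by
        rw [← Real.exp_nat_mul]
        congr 1
        push_cast
        ring
      rw [this, ← mul_pow]
      congr 1
      simp only [mulVec, dotProduct, of_apply, Finset.mul_sum]
      exact Finset.sum_congr rfl fun b _ => by ring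
    · refine Finset.sum_congr rfl fun b _ => ?_
      rw [mul_pow, ← mul_assoc, ← Real.exp_nat_mul, ← Real.exp_add]
      have : u b + ((2 : ℕ) : ℝ) * -(u b / 2) = 0 := by
        push_cast
        ring
      rw [this, Real.exp_zero, one_mul]
  have hright : ∀ z ∈ Complex.re ⁻¹' {(1 : ℝ)}, ‖f z‖ ≤ c := by
    intro z hz
    have hz : z.re = 1 := hz
    have hsplit : ∀ s : ℝ, Complex.exp (z * s) =
        Complex.exp ((z.im * Complex.I : ℂ) * s) * (Real.exp s : ℝ) := fun s => by
      rw [Complex.ofReal_exp, ← Complex.exp_add]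
      congr 1
      nth_rewrite 1 [← Complex.re_add_im z]
      rw [hz]
      push_cast
      ring
    have hfz : f z = ∑ a, ∑ b, (y a * Complex.exp ((z.im * Complex.I : ℂ) * (v a / 2 : ℝ))) *
        ((Matrix.of fun a b => Real.exp (v a / 2) * M a b * Real.exp (-(u b / 2))) a b : ℝ) *
        (x b * Complex.exp ((z.im * Complex.I : ℂ) * (-(u b / 2) : ℝ))) := by
      simp only [hf]
      refine Finset.sum_congr rfl fun a _ => Finset.sum_congr rfl fun b _ => ?_
      rw [hsplit (v a / 2), hsplit (-(u b / 2))]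
      simp only [of_apply, Complex.ofReal_mul]
      ring
    rw [hfz]
    refine (norm_sum_mul_le_of_contraction hT _ _).trans (le_of_eq ?_)
    simp [Complex.norm_exp, hc]
  have hdiff : Differentiable ℂ f := by
    simp only [hf]
    fun_prop
  have hbdd : BddAbove ((norm ∘ f) '' Complex.HadamardThreeLines.verticalClosedStrip 0 1) := by
    refine ⟨∑ a, ∑ b, (|y a| * Real.exp |v a / 2|) * |M a b| *
      (|x b| * Real.exp |-(u b / 2)|), ?_⟩
    rintro _ ⟨z, hz, rfl⟩
    have hz : z.re ∈ Set.Icc (0 : ℝ) 1 := hz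
    have hle : ∀ s : ℝ, z.re * s ≤ |s| := fun s => by
      refine (le_abs_self _).trans ?_
      rw [abs_mul, abs_of_nonneg hz.1]
      exact mul_le_of_le_one_left (abs_nonneg _) hz.2
    refine (norm_sum_le _ _).trans (Finset.sum_le_sum fun a _ =>
      (norm_sum_le _ _).trans (Finset.sum_le_sum fun b _ => ?_))
    simp only [norm_mul, hexp, Complex.norm_real, Real.norm_eq_abs]
    gcongr
    · exact hle _
    · exact hle _
  have hmain := Complex.HadamardThreeLines.norm_le_interp_of_mem_verticalClosedStrip₀₁' f
    (z := (t : ℂ)) (a := c) (b := c) (by simpa [Complex.HadamardThreeLines.verticalClosedStrip]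
      using ht) hdiff.diffContOnCl hbdd hleft hright
  rw [Complex.ofReal_re, ← Real.rpow_add_of_nonneg hc0 (by linarith [ht.2]) ht.1,
    sub_add_cancel, Real.rpow_one] at hmain
  have hft : f t = ((∑ a, y a ^ 2 : ℝ) : ℂ) := by
    simp only [hf, Complex.ofReal_sum]
    refine Finset.sum_congr rfl fun a _ => ?_
    have : ∀ b, (y a * Complex.exp (t * (v a / 2 : ℝ))) * M a b *
        (x b * Complex.exp (t * (-(u b / 2) : ℝ))) =
        ((y a * (Real.exp (t * v a / 2) * (M a b * w b)) : ℝ) : ℂ) := fun b => by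
      have h1 : Real.exp (t * u b / 2) * Real.exp (t * -(u b / 2)) = 1 := by
        rw [← Real.exp_add, ← Real.exp_zero]
        congr 1
        ring
      simp only [← Complex.ofReal_mul, ← Complex.ofReal_exp, hx]
      congr 1
      have h2 : t * (v a / 2) = t * v a / 2 := by ring
      rw [h2]
      linear_combination (y a * Real.exp (t * v a / 2) * M a b * w b) * h1
    rw [Finset.sum_congr rfl fun b _ => this b, ← Complex.ofReal_sum]
    congr 1
    rw [← Finset.mul_sum, ← Finset.mul_sum, pow_two]
    rfl
  rw [hft, Complex.norm_real, Real.norm_eq_abs, abs_of_nonneg (by positivity)] at hmain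
  have hsq : ∀ s r : ℝ, Real.exp (s * r) = Real.exp (s * r / 2) ^ 2 := fun s r => by
    rw [← Real.exp_nat_mul]
    congr 1
    push_cast
    ring
  simp only [hsq, ← mul_pow]
  change ∑ a, y a ^ 2 ≤ ∑ b, x b ^ 2
  linarith

end ThreeLines

section Traces

theorem trace_mul_diagonal_mul {m p q : Type*} [Fintype m] [Fintype p] [Fintype q]
    [DecidableEq p] [DecidableEq q] (G : Matrix m p ℝ) (N : Matrix m q ℝ)
    (f : p → ℝ) (g : q → ℝ) :
    (G * diagonal f * Gᵀ * (N * diagonal g * Nᵀ)).trace =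
      ∑ a, ∑ b, f a * g b * ((Gᵀ * N) a b) ^ 2 := by
  have h1 : (G * diagonal f * Gᵀ * (N * diagonal g * Nᵀ)).trace =
      (diagonal f * (Gᵀ * N) * (diagonal g * (Gᵀ * N)ᵀ)).trace := by
    rw [transpose_mul, transpose_transpose]
    simp only [Matrix.mul_assoc]
    rw [Matrix.trace_mul_comm]
    simp only [Matrix.mul_assoc]
  rw [h1]
  have h2 : ∀ (X : Matrix p q ℝ) (Y : Matrix q p ℝ), (X * Y).trace = ∑ a, ∑ b, X a b * Y b a :=
    fun X Y => by simp [trace, Matrix.mul_apply]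
  rw [h2]
  simp only [diagonal_mul, transpose_apply]
  exact Finset.sum_congr rfl fun a _ => Finset.sum_congr rfl fun b _ => by ring

theorem exp_mul_le_of_mem_Icc {t : ℝ} (ht : t ∈ Set.Icc (0 : ℝ) 1) (x : ℝ) :
    Real.exp (t * x) ≤ (1 - t) + t * Real.exp x := by
  have := convexOn_exp.2 (Set.mem_univ 0) (Set.mem_univ x) (sub_nonneg.2 ht.2) ht.1 (by ring)
  simpa using this

/-- The trace pairing is convex along a pair of geodesics. -/
theorem trace_mul_le_of_geodesic {m : Type*} [Fintype m] [DecidableEq m] (G N : Matrix m m ℝ)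
    (u h : m → ℝ) {t : ℝ} (ht : t ∈ Set.Icc (0 : ℝ) 1) :
    (G * diagonal (fun a => Real.exp (t * u a)) * Gᵀ *
        (N * diagonal (fun a => Real.exp (t * h a)) * Nᵀ)).trace ≤
      (1 - t) * (G * Gᵀ * (N * Nᵀ)).trace +
        t * (G * diagonal (fun a => Real.exp (u a)) * Gᵀ *
          (N * diagonal (fun a => Real.exp (h a)) * Nᵀ)).trace := by
  have h1 : (G * Gᵀ * (N * Nᵀ)).trace =
      (G * diagonal (fun _ => 1) * Gᵀ * (N * diagonal (fun _ => 1) * Nᵀ)).trace := by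
    simp
  rw [h1]
  simp only [trace_mul_diagonal_mul, Finset.mul_sum, ← Finset.sum_add_distrib]
  refine Finset.sum_le_sum fun a _ => Finset.sum_le_sum fun b _ => ?_
  have h2 := exp_mul_le_of_mem_Icc ht (u a + h b)
  rw [mul_add, Real.exp_add, Real.exp_add] at h2
  nlinarith [mul_le_mul_of_nonneg_right h2 (sq_nonneg ((Gᵀ * N) a b))]

theorem isHermitian_mul_diagonal_mul {m p : Type*} [Fintype p] [DecidableEq p]
    (C : Matrix m p ℝ) (f : p → ℝ) : (C * diagonal f * Cᵀ).IsHermitian := by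
  rw [IsHermitian, conjTranspose_eq_transpose_of_trivial, transpose_mul, transpose_mul,
    transpose_transpose, diagonal_transpose, Matrix.mul_assoc]

theorem dotProduct_mul_diagonal_mul {m p : Type*} [Fintype m] [Fintype p] [DecidableEq p]
    (C : Matrix m p ℝ) (f : p → ℝ) (x : m → ℝ) :
    x ⬝ᵥ ((C * diagonal f * Cᵀ) *ᵥ x) = ∑ a, f a * (Cᵀ *ᵥ x) a ^ 2 := by
  rw [← mulVec_mulVec, ← mulVec_mulVec, dotProduct_mulVec, ← mulVec_transpose]
  simp only [dotProduct, mulVec_diagonal]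
  exact Finset.sum_congr rfl fun a _ => by ring

end Traces

section Interpolation

variable {ι κ : Type*} [Fintype ι] [DecidableEq ι] [Fintype κ]
  {n : ι → Type*} [∀ i, Fintype (n i)] [∀ i, DecidableEq (n i)]
  {n' : κ → Type*} [∀ j, Fintype (n' j)] [∀ j, DecidableEq (n' j)]

/-- The operator inequality `∑ⱼ dⱼ Bⱼᵀ Vⱼ Bⱼ ≤ U` is stable under moving `Vⱼ` and `U` along
geodesics. -/
theorem posSemidef_sub_of_geodesic {p : Type*} [Fintype p] [DecidableEq p]
    {d : κ → ℝ} (hd : ∀ j, 0 < d j) (B : ∀ j, Matrix (n' j) p ℝ)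
    {N : Matrix p p ℝ} (hN : IsUnit N) (u : p → ℝ) (P : ∀ j, Matrix (n' j) (n' j) ℝ)
    (v : ∀ j, n' j → ℝ)
    (h0 : (N * Nᵀ - ∑ j, d j • ((B j)ᵀ * (P j * (P j)ᵀ) * B j)).PosSemidef)
    (h1 : (N * diagonal (fun a => Real.exp (u a)) * Nᵀ - ∑ j, d j • ((B j)ᵀ *
      (P j * diagonal (fun a => Real.exp (v j a)) * (P j)ᵀ) * B j)).PosSemidef)
    {t : ℝ} (ht : t ∈ Set.Icc (0 : ℝ) 1) :
    (N * diagonal (fun a => Real.exp (t * u a)) * Nᵀ - ∑ j, d j • ((B j)ᵀ *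
      (P j * diagonal (fun a => Real.exp (t * v j a)) * (P j)ᵀ) * B j)).PosSemidef := by
  have hdet : IsUnit Nᵀ.det := by
    rw [det_transpose]
    exact (Matrix.isUnit_iff_isUnit_det _).1 hN
  -- In the frames of `U` and of the `Vⱼ` the inequality is a weighted `ℓ²` bound for this matrix.
  set M : Matrix (Σ j, n' j) p ℝ :=
    Matrix.of fun ja b => √(d ja.1) * ((P ja.1)ᵀ * B ja.1 * Nᵀ⁻¹) ja.2 b with hM
  have hMw : ∀ (w : p → ℝ) (j : κ) (a : n' j),
      (M *ᵥ w) ⟨j, a⟩ = √(d j) * ((B j)ᵀ * P j)ᵀ.mulVec (Nᵀ⁻¹ *ᵥ w) a := by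
    intro w j a
    rw [transpose_mul, transpose_transpose, mulVec_mulVec]
    simp only [hM, mulVec, dotProduct, of_apply, Finset.mul_sum, mul_assoc]
  have hquad : ∀ (s : ℝ) (w : p → ℝ),
      (Nᵀ⁻¹ *ᵥ w) ⬝ᵥ ((N * diagonal (fun a => Real.exp (s * u a)) * Nᵀ - ∑ j, d j • ((B j)ᵀ *
        (P j * diagonal (fun a => Real.exp (s * v j a)) * (P j)ᵀ) * B j)) *ᵥ (Nᵀ⁻¹ *ᵥ w)) =
      ∑ b, Real.exp (s * u b) * w b ^ 2 -
        ∑ ja : Σ j, n' j, Real.exp (s * v ja.1 ja.2) * (M *ᵥ w) ja ^ 2 := by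
    intro s w
    rw [sub_mulVec, dotProduct_sub, dotProduct_mul_diagonal_mul, sum_mulVec, dotProduct_sum,
      Fintype.sum_sigma]
    congr 1
    · rw [mulVec_mulVec, Matrix.mul_nonsing_inv _ hdet, one_mulVec]
    · refine Finset.sum_congr rfl fun j _ => ?_
      have : (B j)ᵀ * (P j * diagonal (fun a => Real.exp (s * v j a)) * (P j)ᵀ) * B j =
          ((B j)ᵀ * P j) * diagonal (fun a => Real.exp (s * v j a)) * ((B j)ᵀ * P j)ᵀ := by
        rw [transpose_mul, transpose_transpose]
        simp only [Matrix.mul_assoc]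
      rw [this, smul_mulVec, dotProduct_smul, dotProduct_mul_diagonal_mul, smul_eq_mul,
        Finset.mul_sum]
      refine Finset.sum_congr rfl fun a _ => ?_
      rw [hMw, mul_pow, Real.sq_sqrt (hd j).le]
      ring
  have hend : ∀ s : ℝ, (N * diagonal (fun a => Real.exp (s * u a)) * Nᵀ - ∑ j, d j • ((B j)ᵀ *
      (P j * diagonal (fun a => Real.exp (s * v j a)) * (P j)ᵀ) * B j)).PosSemidef →
      ∀ w : p → ℝ, ∑ ja : Σ j, n' j, Real.exp (s * v ja.1 ja.2) * (M *ᵥ w) ja ^ 2 ≤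
        ∑ b, Real.exp (s * u b) * w b ^ 2 := by
    intro s hs w
    have h := hs.dotProduct_mulVec_nonneg (Nᵀ⁻¹ *ᵥ w)
    rw [star_trivial, hquad] at h
    linarith
  have key := sum_exp_mul_sq_le_of_endpoints (M := M) (v := fun ja => v ja.1 ja.2) (u := u)
    (by simpa using hend 0 (by simpa using h0)) (by simpa using hend 1 (by simpa using h1)) ht
  refine PosSemidef.of_dotProduct_mulVec_nonneg ?_ fun x => ?_
  · refine (isHermitian_mul_diagonal_mul N _).sub ?_
    rw [IsHermitian, conjTranspose_sum]
    refine Finset.sum_congr rfl fun j _ => ?_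
    rw [conjTranspose_smul, star_trivial]
    have : (B j)ᵀ * (P j * diagonal (fun a => Real.exp (t * v j a)) * (P j)ᵀ) * B j =
        ((B j)ᵀ * P j) * diagonal (fun a => Real.exp (t * v j a)) * ((B j)ᵀ * P j)ᵀ := by
      rw [transpose_mul, transpose_transpose]
      simp only [Matrix.mul_assoc]
    rw [this, (isHermitian_mul_diagonal_mul _ _).eq]
  · have hx : x = Nᵀ⁻¹ *ᵥ (Nᵀ *ᵥ x) := by
      rw [mulVec_mulVec, Matrix.nonsing_inv_mul _ hdet, one_mulVec]
    rw [star_trivial, hx, hquad]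
    exact sub_nonneg.2 (key _)

end Interpolation

/-! ### Log-convexity of the maximal determinant product -/

section Convexity

variable {ι κ : Type*} [Fintype ι] [DecidableEq ι] [Fintype κ]
  {n : ι → Type*} [∀ i, Fintype (n i)] [∀ i, DecidableEq (n i)]
  {n' : κ → Type*} [∀ j, Fintype (n' j)] [∀ j, DecidableEq (n' j)]

theorem log_det_mul_diagonal_exp_mul_transpose {m : Type*} [Fintype m] [DecidableEq m]
    {P : Matrix m m ℝ} (hP : IsUnit P) (v : m → ℝ) (t : ℝ) :
    Real.log (P * diagonal (fun a => Real.exp (t * v a)) * Pᵀ).det =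
      (1 - t) * Real.log (P * Pᵀ).det +
        t * Real.log (P * diagonal (fun a => Real.exp (v a)) * Pᵀ).det := by
  have h : (P * Pᵀ).det ≠ 0 := by
    have := (posDef_mul_diagonal_exp_mul_transpose hP 0).det_pos.ne'
    simpa using this
  rw [det_mul_diagonal_exp_mul_transpose, det_mul_diagonal_exp_mul_transpose,
    Real.log_mul h (Real.exp_pos _).ne', Real.log_mul h (Real.exp_pos _).ne', Real.log_exp,
    Real.log_exp, ← Finset.mul_sum]
  ring

/-- Weak duality for a coupling: a pair `(U, V)` with `∑ⱼ dⱼ Bⱼᵀ Vⱼ Bⱼ ≤ diag U` bounds the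
logarithm of `detProd`. -/
theorem log_detProd_le_of_dual {d : κ → ℝ} (hd : ∀ j, 0 < d j)
    {B : ∀ j, Matrix (n' j) (Σ i, n i) ℝ} {K : ∀ i, Matrix (n i) (n i) ℝ}
    {S : Matrix (Σ i, n i) (Σ i, n i) ℝ} (hSK : S ∈ gramCouplings K)
    (hS : ∀ j, (B j * S * (B j)ᵀ).PosDef) {U : ∀ i, Matrix (n i) (n i) ℝ}
    {V : ∀ j, Matrix (n' j) (n' j) ℝ} (hV : ∀ j, (V j).PosDef)
    (hUV : (blockDiagonal' U - ∑ j, d j • ((B j)ᵀ * V j * B j)).PosSemidef) :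
    Real.log (detProd d B S) ≤ ∑ i, (U i * K i).trace - ∑ j, d j * Fintype.card (n' j) -
      ∑ j, d j * Real.log (V j).det := by
  rw [log_detProd hS]
  have h1 : ∑ j, d j * (Real.log (B j * S * (B j)ᵀ).det + Real.log (V j).det) ≤
      ∑ j, d j * ((V j * (B j * S * (B j)ᵀ)).trace - Fintype.card (n' j)) :=
    Finset.sum_le_sum fun j _ =>
      mul_le_mul_of_nonneg_left (log_det_add_log_det_le (hS j) (hV j)) (hd j).le
  have h2 : ((∑ j, d j • ((B j)ᵀ * V j * B j)) * S).trace =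
      ∑ j, d j * (V j * (B j * S * (B j)ᵀ)).trace := by
    rw [Matrix.sum_mul, trace_sum]
    refine Finset.sum_congr rfl fun j _ => ?_
    rw [Matrix.smul_mul, trace_smul, smul_eq_mul]
    congr 1
    simp only [Matrix.mul_assoc]
    rw [Matrix.trace_mul_comm]
    simp only [Matrix.mul_assoc]
  have h3 := trace_mul_le_trace_mul hUV hSK.1
  rw [h2, trace_blockDiagonal'_mul] at h3
  simp only [hSK.2] at h3
  simp only [mul_add, mul_sub, Finset.sum_add_distrib, Finset.sum_sub_distrib] at h1
  linarith

/-- Log-convexity of the maximum of `detProd` along the curves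
`t ↦ Nᵢ diag(e^{t hᵢ}) Nᵢᵀ` of marginals. -/
theorem detProd_le_rpow_mul_rpow {d : κ → ℝ} (hd : ∀ j, 0 < d j)
    {B : ∀ j, Matrix (n' j) (Σ i, n i) ℝ} (hB : ∀ j, Function.Injective (B j).vecMul)
    {N : ∀ i, Matrix (n i) (n i) ℝ} (hN : ∀ i, IsUnit (N i)) (h : ∀ i, n i → ℝ)
    {t : ℝ} (ht : t ∈ Set.Icc (0 : ℝ) 1) {m₀ m₁ : ℝ} (hm₀ : 0 < m₀) (hm₁ : 0 < m₁)
    (h₀ : ∀ S ∈ gramCouplings fun i => N i * (N i)ᵀ, detProd d B S ≤ m₀)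
    (h₁ : ∀ S ∈ gramCouplings fun i => N i * diagonal (fun a => Real.exp (h i a)) * (N i)ᵀ,
      detProd d B S ≤ m₁)
    {S : Matrix (Σ i, n i) (Σ i, n i) ℝ}
    (hS : S ∈ gramCouplings fun i => N i * diagonal (fun a => Real.exp (t * h i a)) * (N i)ᵀ) :
    detProd d B S ≤ m₀ ^ (1 - t) * m₁ ^ t := by
  have hm : 0 < m₀ ^ (1 - t) * m₁ ^ t :=
    mul_pos (Real.rpow_pos_of_pos hm₀ _) (Real.rpow_pos_of_pos hm₁ _)
  rcases (detProd_nonneg d B hS.1).eq_or_lt with hz | hpos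
  · exact hz ▸ hm.le
  have hSB : ∀ j, (B j * S * (B j)ᵀ).PosDef := fun j => by
    refine (posSemidef_mul_mul_transpose hS.1 (B j)).posDef_iff_det_ne_zero.2 fun h0 => ?_
    refine hpos.ne' (Finset.prod_eq_zero (Finset.mem_univ j) ?_)
    rw [h0, Real.zero_rpow (hd j).ne']
  rw [← Real.log_le_log_iff hpos hm, Real.log_mul (Real.rpow_pos_of_pos hm₀ _).ne'
    (Real.rpow_pos_of_pos hm₁ _).ne', Real.log_rpow hm₀, Real.log_rpow hm₁]
  have hN0 : ∀ i, (N i * (N i)ᵀ).PosDef := fun i => by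
    simpa using posDef_mul_diagonal_exp_mul_transpose (hN i) 0
  have hN1 := fun i => posDef_mul_diagonal_exp_mul_transpose (hN i) (h i)
  -- It suffices to prove the bound up to an error proportional to the regularisation.
  suffices H : ∀ ε : ℝ, 0 < ε → Real.log (detProd d B S) ≤
      (1 - t) * Real.log m₀ + t * Real.log m₁ + ε * Fintype.card (Σ i, n i) by
    have hlim : Filter.Tendsto (fun ε : ℝ => (1 - t) * Real.log m₀ + t * Real.log m₁ +
        ε * Fintype.card (Σ i, n i)) (𝓝[>] 0)
        (𝓝 ((1 - t) * Real.log m₀ + t * Real.log m₁ + 0 * Fintype.card (Σ i, n i))) :=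
      (Continuous.tendsto (by fun_prop) 0).mono_left nhdsWithin_le_nhds
    rw [zero_mul, add_zero] at hlim
    refine ge_of_tendsto hlim ?_
    filter_upwards [self_mem_nhdsWithin] with ε hε using H ε hε
  intro ε hε
  obtain ⟨S₀, hS₀, hS₀p, U₀, hU₀, hG₀, htr₀⟩ := exists_dual_certificate hd hB hε hN0
  obtain ⟨S₁, hS₁, hS₁p, U₁, hU₁, hG₁, htr₁⟩ := exists_dual_certificate hd hB hε hN1
  have hV₀ := fun j => (posDef_mul_mul_transpose hS₀p (hB j)).inv
  have hV₁ := fun j => (posDef_mul_mul_transpose hS₁p (hB j)).inv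
  choose G u hG hUG₀ hUG₁ using fun i => exists_simultaneous_diagonalization (hU₀ i) (hU₁ i)
  choose P v hP hVP₀ hVP₁ using fun j => exists_simultaneous_diagonalization (hV₀ j) (hV₁ j)
  have hGu : IsUnit (blockDiagonal' G) := by
    refine IsUnit.of_mul_eq_one (blockDiagonal' fun i => (G i)⁻¹) ?_
    rw [← blockDiagonal'_mul, ← blockDiagonal'_one]
    congr 1
    ext1 i
    exact Matrix.mul_nonsing_inv _ ((Matrix.isUnit_iff_isUnit_det _).1 (hG i))
  have hblock : ∀ f : ∀ i, n i → ℝ,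
      blockDiagonal' (fun i => G i * diagonal (f i) * (G i)ᵀ) =
        blockDiagonal' G * diagonal (fun ia : Σ i, n i => f ia.1 ia.2) *
          (blockDiagonal' G)ᵀ := fun f => by
    rw [blockDiagonal'_mul, blockDiagonal'_mul, blockDiagonal'_diagonal, blockDiagonal'_transpose]
  have hblock0 : blockDiagonal' (fun i => G i * (G i)ᵀ) =
      blockDiagonal' G * (blockDiagonal' G)ᵀ := by
    rw [blockDiagonal'_mul, blockDiagonal'_transpose]
  rw [funext hUG₀, hblock0] at hG₀
  rw [funext hUG₁, hblock fun i a => Real.exp (u i a)] at hG₁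
  simp only [hVP₀] at hG₀
  simp only [hVP₁] at hG₁
  have hGt := posSemidef_sub_of_geodesic hd B hGu (fun ia : Σ i, n i => u ia.1 ia.2) P v hG₀ hG₁ ht
  rw [← hblock fun i a => Real.exp (t * u i a)] at hGt
  have hweak := log_detProd_le_of_dual hd hS hSB
    (fun j => posDef_mul_diagonal_exp_mul_transpose (hP j) fun a => t * v j a) hGt
  have hpair : ∑ i, (G i * diagonal (fun a => Real.exp (t * u i a)) * (G i)ᵀ *
      (N i * diagonal (fun a => Real.exp (t * h i a)) * (N i)ᵀ)).trace ≤
      (1 - t) * ∑ i, (U₀ i * (N i * (N i)ᵀ)).trace +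
      t * ∑ i, (U₁ i * (N i * diagonal (fun a => Real.exp (h i a)) * (N i)ᵀ)).trace := by
    rw [Finset.mul_sum, Finset.mul_sum, ← Finset.sum_add_distrib]
    refine Finset.sum_le_sum fun i _ => ?_
    rw [hUG₀, hUG₁]
    exact trace_mul_le_of_geodesic _ _ _ _ ht
  have hlogV : ∑ j, d j * Real.log (P j * diagonal (fun a => Real.exp (t * v j a)) *
      (P j)ᵀ).det = -((1 - t) * Real.log (detProd d B S₀) + t * Real.log (detProd d B S₁)) := by
    rw [log_detProd fun j => posDef_mul_mul_transpose hS₀p (hB j),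
      log_detProd fun j => posDef_mul_mul_transpose hS₁p (hB j), Finset.mul_sum, Finset.mul_sum,
      ← Finset.sum_add_distrib, ← Finset.sum_neg_distrib]
    refine Finset.sum_congr rfl fun j _ => ?_
    rw [log_det_mul_diagonal_exp_mul_transpose (hP j), ← hVP₀, ← hVP₁, det_nonsing_inv,
      det_nonsing_inv, Ring.inverse_eq_inv', Real.log_inv, Real.log_inv]
    ring
  rw [htr₀, htr₁] at hpair
  rw [hlogV] at hweak
  have hl₀ := Real.log_le_log (detProd_pos d hB hS₀p) (h₀ _ hS₀)
  have hl₁ := Real.log_le_log (detProd_pos d hB hS₁p) (h₁ _ hS₁)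
  have hl₀' := mul_le_mul_of_nonneg_left hl₀ (sub_nonneg.2 ht.2)
  have hl₁' := mul_le_mul_of_nonneg_left hl₁ ht.1
  linarith

end Convexity

/-! ### Uniqueness of geodesics of positive definite matrices -/

section Rigidity

/-- A Lipschitz bound that holds to first order at small scales holds at all scales, by subdivision
of the interval. -/
theorem norm_sub_le_of_local_bound {V : Type*} [NormedAddCommGroup V] {f : ℝ → V} {D : ℝ}
    (hf : ∀ s ∈ Set.Icc (0 : ℝ) 1, ∀ t ∈ Set.Icc (0 : ℝ) 1,
      ‖f s - f t‖ ≤ |s - t| * D * Real.exp ((|s - t| * D) ^ 2 / 4))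
    {s t : ℝ} (hs : s ∈ Set.Icc (0 : ℝ) 1) (ht : t ∈ Set.Icc (0 : ℝ) 1) :
    ‖f s - f t‖ ≤ |s - t| * D := by
  set h := |s - t| * D with hh
  have key : ∀ N : ℕ, ‖f s - f t‖ ≤ h * Real.exp ((h / (N + 1)) ^ 2 / 4) := by
    intro N
    have hN : (0 : ℝ) < N + 1 := by positivity
    set g : ℕ → ℝ := fun k => s + k / (N + 1) * (t - s) with hg
    have hmem : ∀ k ≤ N + 1, g k ∈ Set.Icc (0 : ℝ) 1 := by
      intro k hk
      have hk1 : (k : ℝ) / (N + 1) ≤ 1 := (div_le_one hN).2 (by exact_mod_cast hk)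
      have hk0 : 0 ≤ (k : ℝ) / (N + 1) := by positivity
      have := (convex_Icc (0 : ℝ) 1) hs ht (sub_nonneg.2 hk1) hk0 (by ring)
      convert this using 1
      simp only [hg, smul_eq_mul]
      ring
    have hstep : ∀ k, k < N + 1 →
        dist (f (g k)) (f (g (k + 1))) ≤ h / (N + 1) * Real.exp ((h / (N + 1)) ^ 2 / 4) := by
      intro k hk
      have hdiff : |g k - g (k + 1)| * D = h / (N + 1) := by
        have : g k - g (k + 1) = (s - t) / (N + 1) := by
          simp only [hg]
          push_cast
          field_simp
          ring
        rw [this, abs_div, abs_of_pos hN, hh]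
        ring
      have := hf _ (hmem k hk.le) _ (hmem (k + 1) hk)
      rwa [hdiff, ← dist_eq_norm] at this
    have hsum := dist_le_range_sum_of_dist_le (f := fun k => f (g k)) (N + 1)
      (d := fun _ => h / (N + 1) * Real.exp ((h / (N + 1)) ^ 2 / 4)) fun {k} hk => hstep k hk
    have h0 : g 0 = s := by simp [hg]
    have h1 : g (N + 1) = t := by
      simp only [hg]
      push_cast
      rw [div_self hN.ne']
      ring
    rw [h0, h1, dist_eq_norm, Finset.sum_const, Finset.card_range, nsmul_eq_mul] at hsum
    refine hsum.trans (le_of_eq ?_)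
    push_cast
    field_simp
  have hlim : Filter.Tendsto (fun N : ℕ => h * Real.exp ((h / (N + 1)) ^ 2 / 4)) Filter.atTop
      (𝓝 (h * Real.exp (0 ^ 2 / 4))) := by
    have h1 : Filter.Tendsto (fun N : ℕ => h / ((N : ℝ) + 1)) Filter.atTop (𝓝 0) := by
      have := (tendsto_one_div_add_atTop_nhds_zero_nat (𝕜 := ℝ)).const_mul h
      simpa [div_eq_mul_inv] using this
    exact (((h1.pow 2).div_const 4).rexp).const_mul h
  have := ge_of_tendsto' hlim key
  simpa using this

/-- A curve from `0` to `f 1` whose infinitesimal speed is at most `‖f 1‖` is the straight segment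
traversed at constant speed. -/
theorem eq_smul_of_local_bound {V : Type*} [NormedAddCommGroup V] [InnerProductSpace ℝ V]
    {f : ℝ → V} {D : ℝ} (hf : ∀ s ∈ Set.Icc (0 : ℝ) 1, ∀ t ∈ Set.Icc (0 : ℝ) 1,
      ‖f s - f t‖ ≤ |s - t| * D * Real.exp ((|s - t| * D) ^ 2 / 4))
    (h0 : f 0 = 0) (h1 : ‖f 1‖ = D) {t : ℝ} (ht : t ∈ Set.Icc (0 : ℝ) 1) : f t = t • f 1 := by
  have ha := norm_sub_le_of_local_bound hf ht ⟨le_rfl, zero_le_one⟩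
  have hb := norm_sub_le_of_local_bound hf (Set.right_mem_Icc.2 zero_le_one) ht
  rw [h0, sub_zero, sub_zero, abs_of_nonneg ht.1] at ha
  rw [abs_of_nonneg (sub_nonneg.2 ht.2)] at hb
  have ha2 := pow_le_pow_left₀ (norm_nonneg _) ha 2
  have hb2 := pow_le_pow_left₀ (norm_nonneg _) hb 2
  have hexp := norm_sub_sq_real (f 1) (f t)
  have hsq : ‖f t - t • f 1‖ ^ 2 = ‖f t‖ ^ 2 - 2 * t * ⟪f 1, f t⟫_ℝ + t ^ 2 * D ^ 2 := by
    rw [norm_sub_sq_real, real_inner_smul_right, norm_smul, h1, real_inner_comm, Real.norm_eq_abs,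
      mul_pow, sq_abs]
    ring
  rw [h1] at hexp
  have hle : ‖f t - t • f 1‖ ^ 2 ≤ 0 := by
    have hcomb : ‖f t - t • f 1‖ ^ 2 =
        (1 - t) * ‖f t‖ ^ 2 + t * ‖f 1 - f t‖ ^ 2 - t * D ^ 2 + t ^ 2 * D ^ 2 := by
      rw [hsq, hexp]
      ring
    have hb3 := mul_le_mul_of_nonneg_left hb2 ht.1
    have ha3 := mul_le_mul_of_nonneg_left ha2 (sub_nonneg.2 ht.2)
    rw [hcomb]
    linarith
  have : ‖f t - t • f 1‖ = 0 := by
    have := sq_nonneg ‖f t - t • f 1‖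
    exact pow_eq_zero_iff two_ne_zero |>.1 (le_antisymm hle this)
  exact sub_eq_zero.1 (norm_eq_zero.1 this)

end Rigidity

section MatrixMetric

variable {m : Type*} [Fintype m] [DecidableEq m]

/-- The distance `δ₂` on positive definite matrices, from the eigenvalues of `P⁻¹ Q` counted with
multiplicity. -/
noncomputable def matrixDeltaTwo (P Q : Matrix m m ℝ) : ℝ :=
  √(((P⁻¹ * Q).charpoly.roots.map fun l => Real.log l ^ 2).sum)

/-- In a frame that diagonalises both matrices the eigenvalues of `P⁻¹ Q` are the `exp (h x)`. -/
theorem matrixDeltaTwo_sq_of_diagonal {N : Matrix m m ℝ} (hN : IsUnit N) (h : m → ℝ) :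
    matrixDeltaTwo (N * Nᵀ) (N * diagonal (fun x => Real.exp (h x)) * Nᵀ) ^ 2 = ∑ x, h x ^ 2 := by
  have hdet : IsUnit N.det := (Matrix.isUnit_iff_isUnit_det _).1 hN
  have hdet' : IsUnit Nᵀ.det := by rwa [det_transpose]
  have h1 : (N * Nᵀ)⁻¹ * (N * diagonal (fun x => Real.exp (h x)) * Nᵀ) =
      Nᵀ⁻¹ * (diagonal (fun x => Real.exp (h x)) * Nᵀ) := by
    rw [Matrix.mul_inv_rev, Matrix.mul_assoc, Matrix.mul_assoc N, ← Matrix.mul_assoc N⁻¹,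
      Matrix.nonsing_inv_mul _ hdet, Matrix.one_mul]
  have h2 : (Nᵀ⁻¹ * (diagonal (fun x => Real.exp (h x)) * Nᵀ)).charpoly.roots =
      Finset.univ.val.map fun x => Real.exp (h x) := by
    rw [Matrix.charpoly_mul_comm, Matrix.mul_assoc, Matrix.mul_nonsing_inv _ hdet', Matrix.mul_one,
      Matrix.charpoly_diagonal]
    exact Polynomial.roots_multiset_prod_X_sub_C (Finset.univ.val.map fun x => Real.exp (h x)) ▸
      by rw [Multiset.map_map]; rfl
  rw [matrixDeltaTwo, h1, h2, Multiset.map_map, Real.sq_sqrt]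
  · simp
  · exact Multiset.sum_nonneg fun x hx => by
      obtain ⟨y, -, rfl⟩ := Multiset.mem_map.1 hx
      exact sq_nonneg _

theorem trace_inv_mul_add_trace_inv_mul {N : Matrix m m ℝ} (hN : IsUnit N) (h : m → ℝ) :
    ((N * Nᵀ)⁻¹ * (N * diagonal (fun x => Real.exp (h x)) * Nᵀ)).trace +
      ((N * diagonal (fun x => Real.exp (h x)) * Nᵀ)⁻¹ * (N * Nᵀ)).trace =
      ∑ x, 2 * Real.cosh (h x) := by
  have hdet : IsUnit N.det := (Matrix.isUnit_iff_isUnit_det _).1 hN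
  have hdet' : IsUnit Nᵀ.det := by rwa [det_transpose]
  have hinv : (diagonal fun x => Real.exp (h x))⁻¹ = diagonal fun x => Real.exp (-h x) := by
    refine Matrix.inv_eq_right_inv ?_
    rw [diagonal_mul_diagonal]
    simp [← Real.exp_add]
  rw [trace_inv_mul_diagonal_exp hN, Matrix.mul_inv_rev, Matrix.mul_inv_rev, hinv,
    Matrix.mul_assoc, Matrix.mul_assoc, ← Matrix.mul_assoc N⁻¹ N, Matrix.nonsing_inv_mul _ hdet,
    Matrix.one_mul, Matrix.trace_mul_comm, Matrix.mul_assoc, Matrix.mul_nonsing_inv _ hdet',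
    Matrix.mul_one, trace_diagonal, ← Finset.sum_add_distrib]
  refine Finset.sum_congr rfl fun x _ => ?_
  rw [Real.cosh_eq]
  ring

theorem two_mul_cosh_sub_two_le (x : ℝ) : 2 * Real.cosh x - 2 ≤ x ^ 2 * Real.exp (x ^ 2 / 2) := by
  have h1 := Real.cosh_le_exp_half_sq x
  have h2 := Real.add_one_le_exp (-(x ^ 2 / 2))
  have h3 : Real.exp (-(x ^ 2 / 2)) * Real.exp (x ^ 2 / 2) = 1 := by
    rw [← Real.exp_add]
    simp
  nlinarith [mul_le_mul_of_nonneg_right h2 (Real.exp_pos (x ^ 2 / 2)).le]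

theorem sq_le_exp_sub_add_exp_sub (x y : ℝ) :
    (x - y) ^ 2 ≤ Real.exp (y - x) + Real.exp (x - y) - 2 := by
  have h : 1 + (x - y) ^ 2 / 2 ≤ Real.cosh (x - y) := by
    have h1 : Real.cosh (x - y) = 1 + 2 * Real.sinh ((x - y) / 2) ^ 2 := by
      have := Real.cosh_two_mul ((x - y) / 2)
      rw [mul_div_cancel₀ _ two_ne_zero, Real.cosh_sq] at this
      linarith
    have h2 : ((x - y) / 2) ^ 2 ≤ Real.sinh ((x - y) / 2) ^ 2 := by
      rw [sq_le_sq, Real.abs_sinh]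
      exact Real.self_le_sinh_iff.2 (abs_nonneg _)
    linarith
  rw [Real.cosh_eq, neg_sub] at h
  linarith

/-- The traces are bounded by the distance: in terms of `μ = log λ(P⁻¹ Q)` they are
`∑ (2 cosh μ - 2)`, compared with `δ₂² = ∑ μ²`. -/
theorem trace_inv_mul_add_sub_le {P Q : Matrix m m ℝ} (hP : P.PosDef) (hQ : Q.PosDef) :
    (P⁻¹ * Q).trace + (Q⁻¹ * P).trace - 2 * Fintype.card m ≤
      matrixDeltaTwo P Q ^ 2 * Real.exp (matrixDeltaTwo P Q ^ 2 / 2) := by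
  obtain ⟨N, h, hN, rfl, rfl⟩ := exists_simultaneous_diagonalization hP hQ
  rw [matrixDeltaTwo_sq_of_diagonal hN, trace_inv_mul_add_trace_inv_mul hN]
  have h1 : (2 : ℝ) * Fintype.card m = ∑ _x : m, (2 : ℝ) := by
    simp [mul_comm]
  rw [h1, ← Finset.sum_sub_distrib, Finset.sum_mul]
  refine Finset.sum_le_sum fun x _ => (two_mul_cosh_sub_two_le _).trans ?_
  gcongr
  exact Finset.single_le_sum (f := fun x => h x ^ 2) (fun y _ => sq_nonneg _) (Finset.mem_univ x)

theorem exp_mul_diagonal_mul_transpose {O : Matrix m m ℝ} (hO : O * Oᵀ = 1) (a : m → ℝ) :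
    NormedSpace.exp (O * diagonal a * Oᵀ) = O * diagonal (fun x => Real.exp (a x)) * Oᵀ := by
  have h1 : O⁻¹ = Oᵀ := Matrix.inv_eq_right_inv hO
  rw [← h1, Matrix.exp_conj _ _ (IsUnit.of_mul_eq_one _ hO), Matrix.exp_diagonal]
  congr 3
  funext x
  rw [Pi.coe_exp, Real.exp_eq_exp_ℝ]

theorem exists_isHermitian_exp_eq {A : Matrix m m ℝ} (hA : A.PosDef) :
    ∃ L : Matrix m m ℝ, L.IsHermitian ∧ NormedSpace.exp L = A := by
  obtain ⟨O, a, h1, -, h3⟩ := exists_orthogonal_exp hA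
  exact ⟨_, isHermitian_mul_diagonal_mul O a, (exp_mul_diagonal_mul_transpose h1 a).trans h3.symm⟩

theorem sum_sq_eq_trace {L : Matrix m m ℝ} (hL : L.IsHermitian) :
    ∑ a, ∑ b, L a b ^ 2 = (L * L).trace := by
  simp only [trace, diag_apply, Matrix.mul_apply]
  refine Finset.sum_congr rfl fun a _ => Finset.sum_congr rfl fun b _ => ?_
  have : L b a = L a b := by simpa using hL.apply a b
  rw [this, pow_two]

theorem sum_sq_mul_diagonal_mul_transpose {O : Matrix m m ℝ} (hO : Oᵀ * O = 1) (a : m → ℝ) :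
    ∑ x, ∑ y, (O * diagonal a * Oᵀ) x y ^ 2 = ∑ x, a x ^ 2 := by
  rw [sum_sq_eq_trace (isHermitian_mul_diagonal_mul O a), trace_mul_diagonal_mul, hO]
  refine Finset.sum_congr rfl fun x _ => ?_
  rw [Finset.sum_eq_single x]
  · simp [pow_two]
  · intro y _ hy
    simp [Matrix.one_apply_ne hy.symm]
  · simp

/-- To second order the logarithm does not increase distances. With eigenbases of `L` and `L'` and
the doubly stochastic weights `wᵢⱼ` of their overlaps, the inequality is
`∑ wᵢⱼ (aᵢ - bⱼ)² ≤ ∑ wᵢⱼ (2 cosh (aᵢ - bⱼ) - 2)`. -/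
theorem sum_sub_sq_le_trace_exp {L L' : Matrix m m ℝ} (hL : L.IsHermitian) (hL' : L'.IsHermitian) :
    ∑ x, ∑ y, (L x y - L' x y) ^ 2 ≤
      ((NormedSpace.exp L)⁻¹ * NormedSpace.exp L').trace +
        ((NormedSpace.exp L')⁻¹ * NormedSpace.exp L).trace - 2 * Fintype.card m := by
  have hsum := sum_sq_eq_trace (hL.sub hL')
  simp only [Matrix.sub_apply] at hsum
  rw [hsum]
  obtain ⟨O, a, h1, h2, rfl⟩ := exists_orthogonal_diagonal hL
  obtain ⟨O', b, h1', h2', rfl⟩ := exists_orthogonal_diagonal hL'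
  have hinv : ∀ {O : Matrix m m ℝ} (_ : O * Oᵀ = 1) (_ : Oᵀ * O = 1) (a : m → ℝ),
      (O * diagonal (fun x => Real.exp (a x)) * Oᵀ)⁻¹ =
        O * diagonal (fun x => Real.exp (-a x)) * Oᵀ := by
    intro O h1 h2 a
    refine Matrix.inv_eq_right_inv ?_
    have : O * diagonal (fun x => Real.exp (a x)) * Oᵀ *
        (O * diagonal (fun x => Real.exp (-a x)) * Oᵀ) =
        O * (diagonal (fun x => Real.exp (a x)) * (Oᵀ * O) *
          diagonal (fun x => Real.exp (-a x))) * Oᵀ := by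
      simp only [Matrix.mul_assoc]
    rw [this, h2, Matrix.mul_one, diagonal_mul_diagonal]
    simp [← Real.exp_add, h1]
  have hone : ∀ {O : Matrix m m ℝ} (_ : O * Oᵀ = 1),
      (1 : Matrix m m ℝ) = O * diagonal (fun _ => 1) * Oᵀ := by
    intro O h1
    simp [h1]
  have hcard : (2 : ℝ) * Fintype.card m = 2 * ((1 : Matrix m m ℝ) * 1).trace := by simp
  have hLL : ∀ {O : Matrix m m ℝ} (_ : Oᵀ * O = 1) (a : m → ℝ),
      O * diagonal a * Oᵀ * (O * diagonal a * Oᵀ) = O * diagonal (fun x => a x ^ 2) * Oᵀ := by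
    intro O h2 a
    have : O * diagonal a * Oᵀ * (O * diagonal a * Oᵀ) =
        O * (diagonal a * (Oᵀ * O) * diagonal a) * Oᵀ := by
      simp only [Matrix.mul_assoc]
    rw [this, h2, Matrix.mul_one, diagonal_mul_diagonal]
    simp only [pow_two]
  rw [exp_mul_diagonal_mul_transpose h1, exp_mul_diagonal_mul_transpose h1', hinv h1 h2,
    hinv h1' h2', hcard, Matrix.trace_mul_comm (O' * _ * O'ᵀ)]
  have hexpand : ((O * diagonal a * Oᵀ - O' * diagonal b * O'ᵀ) *
      (O * diagonal a * Oᵀ - O' * diagonal b * O'ᵀ)).trace =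
      (O * diagonal (fun x => a x ^ 2) * Oᵀ * 1).trace -
        2 * (O * diagonal a * Oᵀ * (O' * diagonal b * O'ᵀ)).trace +
        (1 * (O' * diagonal (fun x => b x ^ 2) * O'ᵀ)).trace := by
    rw [Matrix.sub_mul, Matrix.mul_sub, Matrix.mul_sub, hLL h2, hLL h2', trace_sub, trace_sub,
      trace_sub, Matrix.trace_mul_comm (O' * _ * O'ᵀ) (O * _ * Oᵀ), Matrix.mul_one, Matrix.one_mul]
    ring
  rw [hexpand]
  have hA : (O * diagonal (fun x => a x ^ 2) * Oᵀ * 1).trace =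
      (O * diagonal (fun x => a x ^ 2) * Oᵀ * (O' * diagonal (fun _ => 1) * O'ᵀ)).trace := by
    rw [← hone h1']
  have hB : (1 * (O' * diagonal (fun x => b x ^ 2) * O'ᵀ)).trace =
      (O * diagonal (fun _ => 1) * Oᵀ * (O' * diagonal (fun x => b x ^ 2) * O'ᵀ)).trace := by
    rw [← hone h1]
  have hC : ((1 : Matrix m m ℝ) * 1).trace =
      (O * diagonal (fun _ => 1) * Oᵀ * (O' * diagonal (fun _ => 1) * O'ᵀ)).trace := by
    rw [← hone h1, ← hone h1']
  rw [hA, hB, hC]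
  simp only [trace_mul_diagonal_mul, Finset.mul_sum, ← Finset.sum_add_distrib,
    ← Finset.sum_sub_distrib]
  refine Finset.sum_le_sum fun x _ => Finset.sum_le_sum fun y _ => ?_
  have h := mul_le_mul_of_nonneg_right (sq_le_exp_sub_add_exp_sub (a x) (b y))
    (sq_nonneg ((Oᵀ * O') x y))
  rw [sub_eq_neg_add (b y), Real.exp_add, sub_eq_add_neg (a x) (b y), Real.exp_add] at h
  linarith

theorem trace_inv_mul_congr {R A A' : Matrix m m ℝ} (hR : IsUnit R) :
    ((R * A * Rᵀ)⁻¹ * (R * A' * Rᵀ)).trace = (A⁻¹ * A').trace := by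
  have hdet : IsUnit R.det := (Matrix.isUnit_iff_isUnit_det _).1 hR
  have hdet' : IsUnit Rᵀ.det := by rwa [det_transpose]
  rw [Matrix.mul_inv_rev, Matrix.mul_inv_rev, Matrix.mul_assoc, Matrix.mul_assoc,
    Matrix.mul_assoc R, ← Matrix.mul_assoc R⁻¹, Matrix.nonsing_inv_mul _ hdet, Matrix.one_mul,
    Matrix.trace_mul_comm, Matrix.mul_assoc, Matrix.mul_assoc, Matrix.mul_nonsing_inv _ hdet',
    Matrix.mul_one]

theorem posDef_congr {R A : Matrix m m ℝ} (hR : IsUnit R) (hA : A.PosDef) : (R * A * Rᵀ).PosDef :=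
  posDef_mul_mul_transpose hA (Matrix.vecMul_injective_of_isUnit hR)

end MatrixMetric

section Geodesics

variable {ι : Type*} [Fintype ι] {n : ι → Type*} [∀ i, Fintype (n i)] [∀ i, DecidableEq (n i)]

/-- Geodesics of the product metric are unique: in the logarithmic chart at the initial point, which
is isometric along rays and does not increase distances, they become straight segments. -/
theorem exists_diagonal_of_isGeodesic {γ : ℝ → ∀ i, Matrix (n i) (n i) ℝ}
    (hγ : IsGeodesic (fun K L : ∀ i, Matrix (n i) (n i) ℝ => √(∑ i, matrixDeltaTwo (K i) (L i) ^ 2))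
      {K | ∀ i, (K i).PosDef} γ) :
    ∃ (N : ∀ i, Matrix (n i) (n i) ℝ) (h : ∀ i, n i → ℝ), (∀ i, IsUnit (N i)) ∧
      ∀ t ∈ Set.Icc (0 : ℝ) 1, ∀ i,
        γ t i = N i * diagonal (fun a => Real.exp (t * h i a)) * (N i)ᵀ := by
  obtain ⟨hpd, hdist⟩ := hγ
  have hI0 : (0 : ℝ) ∈ Set.Icc (0 : ℝ) 1 := Set.left_mem_Icc.2 zero_le_one
  have hI1 : (1 : ℝ) ∈ Set.Icc (0 : ℝ) 1 := Set.right_mem_Icc.2 zero_le_one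
  choose R hR hγ0 using fun i => exists_isUnit_mul_transpose (hpd 0 hI0 i)
  have hchart : ∀ (t : ℝ) (i : ι), ∃ L : Matrix (n i) (n i) ℝ, L.IsHermitian ∧
      (t ∈ Set.Icc (0 : ℝ) 1 → γ t i = R i * NormedSpace.exp L * (R i)ᵀ) := by
    intro t i
    by_cases ht : t ∈ Set.Icc (0 : ℝ) 1
    · obtain ⟨L, hL, hLe⟩ := exists_isHermitian_exp_eq
        (posDef_congr ((Matrix.isUnit_nonsing_inv_iff).2 (hR i)) (hpd t ht i))
      have hdet : IsUnit (R i).det := (Matrix.isUnit_iff_isUnit_det _).1 (hR i)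
      have hdet' : IsUnit (R i)ᵀ.det := by rwa [det_transpose]
      refine ⟨L, hL, fun _ => ?_⟩
      rw [hLe, transpose_nonsing_inv]
      simp only [← Matrix.mul_assoc]
      rw [Matrix.mul_nonsing_inv _ hdet, Matrix.one_mul, Matrix.mul_assoc,
        Matrix.nonsing_inv_mul _ hdet', Matrix.mul_one]
    · exact ⟨0, isHermitian_zero, fun h => absurd h ht⟩
  -- `L t i` is the logarithm of `γ t i` seen from `γ 0 i = R i (R i)ᵀ`.
  choose L hL hγL using hchart
  set f : ℝ → EuclideanSpace ℝ (Σ i, n i × n i) :=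
    fun t => WithLp.toLp 2 fun p => L t p.1 p.2.1 p.2.2 with hf
  have hnorm : ∀ s t : ℝ, ‖f s - f t‖ ^ 2 =
      ∑ i, ∑ a, ∑ b, (L s i a b - L t i a b) ^ 2 := by
    intro s t
    rw [EuclideanSpace.norm_sq_eq, Fintype.sum_sigma]
    refine Finset.sum_congr rfl fun i _ => ?_
    rw [Fintype.sum_prod_type]
    simp [hf]
  set D := √(∑ i, matrixDeltaTwo (γ 0 i) (γ 1 i) ^ 2) with hD
  have hD0 : 0 ≤ D := Real.sqrt_nonneg _
  have hexpd : ∀ t ∈ Set.Icc (0 : ℝ) 1, ∀ i, (NormedSpace.exp (L t i)).PosDef := by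
    intro t _ i
    obtain ⟨O, a, h1, -, h3⟩ := exists_orthogonal_diagonal (hL t i)
    rw [h3, exp_mul_diagonal_mul_transpose h1]
    exact posDef_mul_diagonal_exp_mul_transpose (IsUnit.of_mul_eq_one _ h1) a
  have hlocal : ∀ s ∈ Set.Icc (0 : ℝ) 1, ∀ t ∈ Set.Icc (0 : ℝ) 1,
      ‖f s - f t‖ ≤ |s - t| * D * Real.exp ((|s - t| * D) ^ 2 / 4) := by
    intro s hs t ht
    have hρ0 : 0 ≤ ∑ i, matrixDeltaTwo (γ s i) (γ t i) ^ 2 :=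
      Finset.sum_nonneg fun i _ => sq_nonneg _
    have hρ : (|s - t| * D) ^ 2 = ∑ i, matrixDeltaTwo (γ s i) (γ t i) ^ 2 := by
      rw [← hdist s hs t ht, Real.sq_sqrt hρ0]
    refine (pow_le_pow_iff_left₀ (norm_nonneg _) (by positivity) two_ne_zero).1 ?_
    have he : Real.exp ((|s - t| * D) ^ 2 / 4) ^ 2 = Real.exp ((|s - t| * D) ^ 2 / 2) := by
      rw [← Real.exp_nat_mul]
      congr 1
      push_cast
      ring
    rw [mul_pow, he, hρ, hnorm, Finset.sum_mul]
    refine Finset.sum_le_sum fun i _ => ?_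
    have h1 := sum_sub_sq_le_trace_exp (hL s i) (hL t i)
    rw [← trace_inv_mul_congr (hR i), ← trace_inv_mul_congr (A := NormedSpace.exp (L t i)) (hR i),
      ← hγL s i hs, ← hγL t i ht] at h1
    refine h1.trans ((trace_inv_mul_add_sub_le (hpd s hs i) (hpd t ht i)).trans ?_)
    gcongr
    exact Finset.single_le_sum (f := fun i => matrixDeltaTwo (γ s i) (γ t i) ^ 2)
      (fun j _ => sq_nonneg _) (Finset.mem_univ i)
  choose O a hO hO' hLO using fun i => exists_orthogonal_diagonal (hL 1 i)
  have hLzero : ∀ i, L 0 i = 0 := by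
    intro i
    have hexp1 : NormedSpace.exp (L 0 i) = 1 := by
      have h1 : R i * NormedSpace.exp (L 0 i) * (R i)ᵀ = R i * 1 * (R i)ᵀ := by
        rw [← hγL 0 i hI0, Matrix.mul_one, ← hγ0]
      exact (hR i).mul_left_cancel (((Matrix.isUnit_transpose _).2 (hR i)).mul_right_cancel h1)
    have h1 := sum_sub_sq_le_trace_exp (hL 0 i) (isHermitian_zero (n := n i) (α := ℝ))
    have h2 : ∑ x, ∑ y, (L 0 i x y - (0 : Matrix (n i) (n i) ℝ) x y) ^ 2 =
        ((L 0 i)ᴴ * L 0 i).trace := by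
      rw [(hL 0 i).eq, ← sum_sq_eq_trace (hL 0 i)]
      simp
    rw [h2, hexp1, NormedSpace.exp_zero, inv_one, Matrix.mul_one, trace_one] at h1
    refine trace_conjTranspose_mul_self_eq_zero_iff.1 (le_antisymm (by linarith) ?_)
    exact (posSemidef_conjTranspose_mul_self _).trace_nonneg
  have hL0 : f 0 = 0 := by
    ext p
    simp [hf, hLzero]
  have hL1 : ‖f 1‖ = D := by
    refine (sq_eq_sq₀ (norm_nonneg _) hD0).1 ?_
    have h1 := hnorm 1 0
    rw [hL0, sub_zero] at h1
    rw [h1, hD, Real.sq_sqrt (Finset.sum_nonneg fun i _ => sq_nonneg _)]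
    refine Finset.sum_congr rfl fun i _ => ?_
    have h2 : γ 0 i = R i * O i * (R i * O i)ᵀ := by
      rw [hγ0, transpose_mul, Matrix.mul_assoc, ← Matrix.mul_assoc (O i), hO, Matrix.one_mul]
    have h3 : γ 1 i = R i * O i * diagonal (fun x => Real.exp (a i x)) * (R i * O i)ᵀ := by
      rw [hγL 1 i hI1, hLO, exp_mul_diagonal_mul_transpose (hO i), transpose_mul]
      simp only [Matrix.mul_assoc]
    rw [h2, h3, matrixDeltaTwo_sq_of_diagonal ((hR i).mul (IsUnit.of_mul_eq_one _ (hO i))),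
      ← sum_sq_mul_diagonal_mul_transpose (hO' i), ← hLO, hLzero]
    simp
  refine ⟨fun i => R i * O i, a, fun i => (hR i).mul (IsUnit.of_mul_eq_one _ (hO i)), ?_⟩
  intro t ht i
  have hft := eq_smul_of_local_bound hlocal hL0 hL1 ht
  have hLt : L t i = O i * diagonal (fun x => t * a i x) * (O i)ᵀ := by
    have h1 : L t i = t • L 1 i := by
      ext x y
      have := congrArg (fun v : EuclideanSpace ℝ (Σ i, n i × n i) => v ⟨i, x, y⟩) hft
      simpa [hf] using this
    have h2 : (diagonal fun x => t * a i x) = t • diagonal (a i) := by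
      rw [← diagonal_smul]
      rfl
    rw [h1, h2, hLO]
    simp
  rw [hγL t i ht, hLt, exp_mul_diagonal_mul_transpose (hO i), transpose_mul]
  simp only [Matrix.mul_assoc]

end Geodesics

/-! ### The maximum as a function of the marginals -/

section Maximum

variable {ι κ : Type*} [Fintype ι] [DecidableEq ι] [Fintype κ]
  {n : ι → Type*} [∀ i, Fintype (n i)] [∀ i, DecidableEq (n i)]
  {n' : κ → Type*} [∀ j, Fintype (n' j)] [∀ j, DecidableEq (n' j)]

/-- The maximum of `detProd` over the couplings of given marginals. -/
noncomputable def maxDetProd (d : κ → ℝ) (B : ∀ j, Matrix (n' j) (Σ i, n i) ℝ)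
    (K : ∀ i, Matrix (n i) (n i) ℝ) : ℝ :=
  sSup (detProd d B '' gramCouplings K)

theorem detProd_le_maxDetProd {d : κ → ℝ} (hd : ∀ j, 0 < d j) (B : ∀ j, Matrix (n' j) (Σ i, n i) ℝ)
    {K : ∀ i, Matrix (n i) (n i) ℝ} {S : Matrix (Σ i, n i) (Σ i, n i) ℝ}
    (hS : S ∈ gramCouplings K) : detProd d B S ≤ maxDetProd d B K :=
  le_csSup ((isCompact_gramCouplings K).bddAbove_image (continuous_detProd hd B).continuousOn)
    (Set.mem_image_of_mem _ hS)

theorem exists_detProd_eq_maxDetProd {d : κ → ℝ} (hd : ∀ j, 0 < d j)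
    (B : ∀ j, Matrix (n' j) (Σ i, n i) ℝ) {K : ∀ i, Matrix (n i) (n i) ℝ}
    (hK : ∀ i, (K i).PosDef) : ∃ S ∈ gramCouplings K, detProd d B S = maxDetProd d B K :=
  (((isCompact_gramCouplings K).image (continuous_detProd hd B)).sSup_mem
    (Set.Nonempty.image _ ⟨_, blockDiagonal'_mem_gramCouplings hK⟩))

theorem rpow_mul_maxDetProd_le {d : κ → ℝ} (hd : ∀ j, 0 < d j)
    (B : ∀ j, Matrix (n' j) (Σ i, n i) ℝ) {K L : ∀ i, Matrix (n i) (n i) ℝ} {r : ℝ} (hr : 0 < r)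
    (hL : ∀ i, (L i).PosDef) (hKL : ∀ i, (K i - r • L i).PosDef) :
    r ^ (∑ j, d j * Fintype.card (n' j)) * maxDetProd d B L ≤ maxDetProd d B K := by
  obtain ⟨S, hS, hSe⟩ := exists_detProd_eq_maxDetProd hd B hL
  obtain ⟨S', hS', hle⟩ := exists_gramCouplings_rpow_mul_detProd_le hd B hr hKL hS
  rw [← hSe]
  exact hle.trans (detProd_le_maxDetProd hd B hS')

/-- Continuity of the maximum: for `L` near `K` and `r < 1` both `L - r K` and `K - r L` are
positive definite, so the two maxima agree up to the factor `r ^ N`, which tends to `1`. -/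
theorem continuousOn_maxDetProd {d : κ → ℝ} (hd : ∀ j, 0 < d j)
    (B : ∀ j, Matrix (n' j) (Σ i, n i) ℝ) :
    ContinuousOn (maxDetProd d B) {K | ∀ i, (K i).PosDef} := by
  intro K hK
  set N := ∑ j, d j * (Fintype.card (n' j) : ℝ) with hN
  set P := maxDetProd d B K with hP
  have hpd : ∀ r : ℝ, r < 1 → ∀ i, (K i - r • K i).PosDef := fun r hr i => by
    have : K i - r • K i = (1 - r) • K i := by rw [sub_smul, one_smul]
    rw [this]
    exact (hK i).smul (sub_pos.2 hr)
  have hlow : ∀ r : ℝ, 0 < r → r < 1 →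
      ∀ᶠ L in 𝓝[{K | ∀ i, (K i).PosDef}] K, r ^ N * P ≤ maxDetProd d B L := by
    intro r hr0 hr1
    have h1 : ∀ i, ∀ᶠ L in 𝓝[{K : ∀ i, Matrix (n i) (n i) ℝ | ∀ i, (K i).PosDef}] K,
        (L i - r • K i).PosDef := by
      intro i
      have hc : Continuous fun L : ∀ i, Matrix (n i) (n i) ℝ => L i - r • K i := by fun_prop
      filter_upwards [nhdsWithin_le_nhds
        (hc.continuousAt.eventually (eventually_posDef (hpd r hr1 i))),
        self_mem_nhdsWithin] with L hL hLp
      exact hL ((hLp i).isHermitian.sub ((hK i).posSemidef.smul hr0.le).isHermitian)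
    filter_upwards [Filter.eventually_all.2 h1] with L hL
    exact rpow_mul_maxDetProd_le hd B hr0 hK hL
  have hupp : ∀ r : ℝ, 0 < r → r < 1 →
      ∀ᶠ L in 𝓝[{K | ∀ i, (K i).PosDef}] K, r ^ N * maxDetProd d B L ≤ P := by
    intro r hr0 hr1
    have h1 : ∀ i, ∀ᶠ L in 𝓝[{K : ∀ i, Matrix (n i) (n i) ℝ | ∀ i, (K i).PosDef}] K,
        (K i - r • L i).PosDef := by
      intro i
      have hc : Continuous fun L : ∀ i, Matrix (n i) (n i) ℝ => K i - r • L i := by fun_prop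
      filter_upwards [nhdsWithin_le_nhds
        (hc.continuousAt.eventually (eventually_posDef (hpd r hr1 i))),
        self_mem_nhdsWithin] with L hL hLp
      exact hL ((hK i).isHermitian.sub ((hLp i).posSemidef.smul hr0.le).isHermitian)
    filter_upwards [Filter.eventually_all.2 h1, self_mem_nhdsWithin] with L hL hLp
    exact rpow_mul_maxDetProd_le hd B hr0 hLp hL
  have hr : ∀ c : ℝ, Filter.Tendsto (fun r : ℝ => r ^ N * c) (𝓝[<] 1) (𝓝 c) := by
    intro c
    have h : ContinuousAt (fun r : ℝ => r ^ N * c) 1 :=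
      (Real.continuousAt_rpow_const 1 N (Or.inl one_ne_zero)).mul continuousAt_const
    have h2 := h.tendsto
    rw [Real.one_rpow, one_mul] at h2
    exact h2.mono_left nhdsWithin_le_nhds
  have hI : ∀ᶠ r in 𝓝[<] (1 : ℝ), 0 < r ∧ r < 1 := Ioo_mem_nhdsLT zero_lt_one
  refine tendsto_order.2 ⟨fun a ha => ?_, fun b hb => ?_⟩
  · obtain ⟨r, hra, hr0, hr1⟩ := (((hr P).eventually (lt_mem_nhds ha)).and hI).exists
    filter_upwards [hlow r hr0 hr1] with L hL using hra.trans_le hL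
  · obtain ⟨r, hrb, hr0, hr1⟩ := (((hr b).eventually (lt_mem_nhds hb)).and hI).exists
    filter_upwards [hupp r hr0 hr1] with L hL
    exact lt_of_mul_lt_mul_left (hL.trans_lt hrb) (Real.rpow_nonneg hr0.le _)

theorem maxDetProd_pos {d : κ → ℝ} (hd : ∀ j, 0 < d j) {B : ∀ j, Matrix (n' j) (Σ i, n i) ℝ}
    (hB : ∀ j, Function.Injective (B j).vecMul) {K : ∀ i, Matrix (n i) (n i) ℝ}
    (hK : ∀ i, (K i).PosDef) : 0 < maxDetProd d B K :=
  (detProd_pos d hB (posDef_blockDiagonal' hK)).trans_le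
    (detProd_le_maxDetProd hd B (blockDiagonal'_mem_gramCouplings hK))

theorem maxDetProd_eq_zero {d : κ → ℝ} (hd : ∀ j, 0 < d j) {B : ∀ j, Matrix (n' j) (Σ i, n i) ℝ}
    {j : κ} (hB : ¬ Function.Injective (B j).vecMul) {K : ∀ i, Matrix (n i) (n i) ℝ}
    (hK : ∀ i, (K i).PosDef) : maxDetProd d B K = 0 := by
  obtain ⟨S, -, hS⟩ := exists_detProd_eq_maxDetProd hd B hK
  rw [← hS, detProd_eq_zero hd hB]

/-- The logarithm of the maximum is convex along geodesics, given in their explicit form. -/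
theorem log_maxDetProd_le_of_geodesic {d : κ → ℝ} (hd : ∀ j, 0 < d j)
    {B : ∀ j, Matrix (n' j) (Σ i, n i) ℝ} (hB : ∀ j, Function.Injective (B j).vecMul)
    {γ : ℝ → ∀ i, Matrix (n i) (n i) ℝ} {N : ∀ i, Matrix (n i) (n i) ℝ} {h : ∀ i, n i → ℝ}
    (hN : ∀ i, IsUnit (N i)) (hγ : ∀ t ∈ Set.Icc (0 : ℝ) 1, ∀ i,
      γ t i = N i * diagonal (fun a => Real.exp (t * h i a)) * (N i)ᵀ)
    {t : ℝ} (ht : t ∈ Set.Icc (0 : ℝ) 1) :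
    Real.log (maxDetProd d B (γ t)) ≤
      (1 - t) * Real.log (maxDetProd d B (γ 0)) + t * Real.log (maxDetProd d B (γ 1)) := by
  have h0 : γ 0 = fun i => N i * (N i)ᵀ := by
    funext i
    simp [hγ 0 (Set.left_mem_Icc.2 zero_le_one)]
  have h1 : γ 1 = fun i => N i * diagonal (fun a => Real.exp (h i a)) * (N i)ᵀ := by
    funext i
    simp [hγ 1 (Set.right_mem_Icc.2 zero_le_one)]
  have hpd : ∀ s ∈ Set.Icc (0 : ℝ) 1, ∀ i, (γ s i).PosDef := fun s hs i => by
    rw [hγ s hs i]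
    exact posDef_mul_diagonal_exp_mul_transpose (hN i) _
  have hm₀ := maxDetProd_pos hd hB (hpd 0 (Set.left_mem_Icc.2 zero_le_one))
  have hm₁ := maxDetProd_pos hd hB (hpd 1 (Set.right_mem_Icc.2 zero_le_one))
  obtain ⟨S, hS, hSe⟩ := exists_detProd_eq_maxDetProd hd B (hpd t ht)
  have hS' : S ∈ gramCouplings fun i =>
      N i * diagonal (fun a => Real.exp (t * h i a)) * (N i)ᵀ := by
    rwa [funext (hγ t ht)] at hS
  have key := detProd_le_rpow_mul_rpow hd hB hN h ht hm₀ hm₁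
    (fun S hS => detProd_le_maxDetProd hd B (h0 ▸ hS))
    (fun S hS => detProd_le_maxDetProd hd B (h1 ▸ hS)) hS'
  rw [hSe] at key
  have := Real.log_le_log (maxDetProd_pos hd hB (hpd t ht)) key
  rwa [Real.log_mul (Real.rpow_pos_of_pos hm₀ _).ne' (Real.rpow_pos_of_pos hm₁ _).ne',
    Real.log_rpow hm₀, Real.log_rpow hm₁] at this

end Maximum

theorem coe_finset_sum {α : Type*} (s : Finset α) (f : α → ℝ) :
    ((∑ x ∈ s, f x : ℝ) : EReal) = ∑ x ∈ s, (f x : EReal) := by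
  classical
  induction s using Finset.induction_on with
  | empty => simp
  | insert a s ha ih => rw [Finset.sum_insert ha, Finset.sum_insert ha, EReal.coe_add, ih]

/-! ### Operators in orthonormal coordinates -/

section Coordinates

variable {F G H : Type*} [NormedAddCommGroup F] [InnerProductSpace ℝ F] [FiniteDimensional ℝ F]
  [NormedAddCommGroup G] [InnerProductSpace ℝ G] [FiniteDimensional ℝ G]
  [NormedAddCommGroup H] [InnerProductSpace ℝ H] [FiniteDimensional ℝ H]
  {p q r : Type*} [Fintype p] [DecidableEq p] [Fintype q] [DecidableEq q] [Fintype r]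
  [DecidableEq r]

/-- The matrix of an operator with respect to orthonormal bases. -/
noncomputable def opMatrix (b : OrthonormalBasis p ℝ F) (b' : OrthonormalBasis q ℝ G)
    (T : F →L[ℝ] G) : Matrix q p ℝ :=
  LinearMap.toMatrix b.toBasis b'.toBasis (T : F →ₗ[ℝ] G)

theorem opMatrix_apply (b : OrthonormalBasis p ℝ F) (b' : OrthonormalBasis q ℝ G)
    (T : F →L[ℝ] G) (x : q) (y : p) : opMatrix b b' T x y = ⟪b' x, T (b y)⟫_ℝ := by
  rw [opMatrix, LinearMap.toMatrix_apply]
  simp [OrthonormalBasis.repr_apply_apply]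

theorem opMatrix_comp (b : OrthonormalBasis p ℝ F) (b' : OrthonormalBasis q ℝ G)
    (b'' : OrthonormalBasis r ℝ H) (T : G →L[ℝ] H) (T' : F →L[ℝ] G) :
    opMatrix b b'' (T ∘L T') = opMatrix b' b'' T * opMatrix b b' T' :=
  LinearMap.toMatrix_comp b.toBasis b'.toBasis b''.toBasis (T : G →ₗ[ℝ] H) (T' : F →ₗ[ℝ] G)

theorem opMatrix_adjoint (b : OrthonormalBasis p ℝ F) (b' : OrthonormalBasis q ℝ G)
    (T : F →L[ℝ] G) :
    opMatrix b' b (ContinuousLinearMap.adjoint T) = (opMatrix b b' T)ᵀ := by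
  ext x y
  rw [transpose_apply, opMatrix_apply, opMatrix_apply, ContinuousLinearMap.adjoint_inner_right,
    real_inner_comm]

theorem det_opMatrix (b : OrthonormalBasis p ℝ F) (T : F →L[ℝ] F) :
    (opMatrix b b T).det = T.det :=
  LinearMap.det_toMatrix b.toBasis (T : F →ₗ[ℝ] F)

theorem posSemidef_opMatrix_iff (b : OrthonormalBasis p ℝ F) (T : F →L[ℝ] F) :
    (opMatrix b b T).PosSemidef ↔ T.IsPositive :=
  (LinearMap.posSemidef_toMatrix_iff b).trans (ContinuousLinearMap.isPositive_toLinearMap_iff T)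

theorem injective_of_mem_posDef {T : F →L[ℝ] F} (hT : T ∈ posDef F) : Function.Injective T := by
  refine (injective_iff_map_eq_zero T).2 fun x hx => ?_
  by_contra h0
  have := hT.2 x h0
  simp [hx] at this

theorem opMatrix_inverse_mul (b : OrthonormalBasis p ℝ F) {T : F →L[ℝ] F} (hT : T ∈ posDef F) :
    opMatrix b b T.inverse * opMatrix b b T = 1 := by
  set e : F ≃L[ℝ] F := (LinearEquiv.ofInjectiveEndo (T : F →ₗ[ℝ] F)
    (injective_of_mem_posDef hT)).toContinuousLinearEquiv with he
  have hTe : T = (e : F →L[ℝ] F) := by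
    ext x
    rfl
  rw [← opMatrix_comp]
  have : T.inverse ∘L T = ContinuousLinearMap.id ℝ F := by
    rw [hTe, ContinuousLinearMap.inverse_equiv]
    ext x
    simp
  rw [this]
  exact LinearMap.toMatrix_id b.toBasis

theorem posDef_opMatrix (b : OrthonormalBasis p ℝ F) {T : F →L[ℝ] F} (hT : T ∈ posDef F) :
    (opMatrix b b T).PosDef := by
  have hpos : T.IsPositive := by
    refine (ContinuousLinearMap.isPositive_iff T).2 ⟨hT.1, fun x => ?_⟩
    by_cases hx : x = 0
    · simp [hx]
    · rw [real_inner_comm]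
      exact (hT.2 x hx).le
  refine ((posSemidef_opMatrix_iff b T).2 hpos).posDef_iff_det_ne_zero.2 fun h0 => ?_
  have := congrArg Matrix.det (opMatrix_inverse_mul b hT)
  rw [det_mul, h0, mul_zero, det_one] at this
  exact zero_ne_one this

theorem deltaTwo_eq_matrixDeltaTwo (b : OrthonormalBasis p ℝ F) {T : F →L[ℝ] F}
    (hT : T ∈ posDef F) (T' : F →L[ℝ] F) :
    deltaTwo T T' = matrixDeltaTwo (opMatrix b b T) (opMatrix b b T') := by
  have h : (opMatrix b b T)⁻¹ = opMatrix b b T.inverse :=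
    Matrix.inv_eq_left_inv (opMatrix_inverse_mul b hT)
  rw [deltaTwo, matrixDeltaTwo, h, ← opMatrix_comp]
  rw [opMatrix, LinearMap.charpoly_toMatrix]

theorem logDet_eq_log {T : F →L[ℝ] F} (hT : T ∈ posDef F) :
    logDet T = ((Real.log T.det : ℝ) : EReal) := by
  refine ENNReal.log_ofReal_of_pos ?_
  rw [← det_opMatrix (stdOrthonormalBasis ℝ F)]
  exact (posDef_opMatrix _ hT).det_pos

theorem continuous_opMatrix (b : OrthonormalBasis p ℝ F) (b' : OrthonormalBasis q ℝ G) :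
    Continuous (opMatrix b b') := by
  refine continuous_matrix fun x y => ?_
  simp only [opMatrix_apply]
  exact continuous_const.inner (ContinuousLinearMap.apply ℝ G (b y)).continuous

end Coordinates

/-! ### The objective in terms of matrices -/

section Transfer

variable {k m : ℕ}
  {E : Fin k → Type*} [∀ i, NormedAddCommGroup (E i)] [∀ i, InnerProductSpace ℝ (E i)]
  [∀ i, FiniteDimensional ℝ (E i)]
  {E' : Fin m → Type*} [∀ j, NormedAddCommGroup (E' j)] [∀ j, InnerProductSpace ℝ (E' j)]
  [∀ j, FiniteDimensional ℝ (E' j)]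

variable (E) in
/-- The coordinate matrices of a tuple of operators in the standard orthonormal bases. -/
noncomputable def tupleMatrix (K : ∀ i, E i →L[ℝ] E i) :
    ∀ i, Matrix (Fin (Module.finrank ℝ (E i))) (Fin (Module.finrank ℝ (E i))) ℝ :=
  fun i => opMatrix (stdOrthonormalBasis ℝ (E i)) (stdOrthonormalBasis ℝ (E i)) (K i)

variable (E) in
/-- The orthonormal basis of `⨁ᵢ Eᵢ` assembled from those of the summands. -/
noncomputable def sumBasis :
    OrthonormalBasis (Σ i, Fin (Module.finrank ℝ (E i))) ℝ (PiLp 2 E) :=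
  Pi.orthonormalBasis fun i => stdOrthonormalBasis ℝ (E i)

/-- The coordinate matrices of the maps `Bⱼ`. -/
noncomputable def datumMatrix (B : ∀ j, PiLp 2 E →L[ℝ] E' j) (j : Fin m) :
    Matrix (Fin (Module.finrank ℝ (E' j))) (Σ i, Fin (Module.finrank ℝ (E i))) ℝ :=
  opMatrix (sumBasis E) (stdOrthonormalBasis ℝ (E' j)) (B j)

theorem adjoint_proj_apply (i : Fin k) (v : E i) :
    ContinuousLinearMap.adjoint (PiLp.proj (𝕜 := ℝ) 2 E i) v = PiLp.single 2 i v := by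
  refine ext_inner_right ℝ fun w => ?_
  rw [ContinuousLinearMap.adjoint_inner_left, PiLp.inner_apply, Finset.sum_eq_single i]
  · simp
  · intro i' _ hi
    simp [hi]
  · simp

/-- The diagonal blocks of the matrix of `S` are the matrices of the compressions `πᵢ S πᵢᵀ`. -/
theorem opMatrix_block (S : PiLp 2 E →L[ℝ] PiLp 2 E) (i : Fin k) :
    opMatrix (stdOrthonormalBasis ℝ (E i)) (stdOrthonormalBasis ℝ (E i))
      (PiLp.proj (𝕜 := ℝ) 2 E i ∘L S ∘L ContinuousLinearMap.adjoint (PiLp.proj (𝕜 := ℝ) 2 E i)) =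
      blockDiag' (opMatrix (sumBasis E) (sumBasis E) S) i := by
  ext x y
  rw [opMatrix_apply, blockDiag'_apply, opMatrix_apply, sumBasis, Pi.orthonormalBasis_apply,
    Pi.orthonormalBasis_apply, ContinuousLinearMap.comp_apply, ContinuousLinearMap.comp_apply,
    ← ContinuousLinearMap.adjoint_inner_left, adjoint_proj_apply, adjoint_proj_apply]

theorem opMatrix_injective {F G p q : Type*} [NormedAddCommGroup F] [InnerProductSpace ℝ F]
    [NormedAddCommGroup G] [InnerProductSpace ℝ G] [Fintype p]
    [DecidableEq p] [Fintype q] [DecidableEq q] [FiniteDimensional ℝ F] [FiniteDimensional ℝ G]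
    (b : OrthonormalBasis p ℝ F) (b' : OrthonormalBasis q ℝ G) :
    Function.Injective (opMatrix b b') := fun _ _ h =>
  ContinuousLinearMap.coe_injective ((LinearMap.toMatrix b.toBasis b'.toBasis).injective h)

theorem opMatrix_mem_gramCouplings_iff {K : ∀ i, E i →L[ℝ] E i} {S : PiLp 2 E →L[ℝ] PiLp 2 E} :
    opMatrix (sumBasis E) (sumBasis E) S ∈ gramCouplings (tupleMatrix E K) ↔
      S ∈ matrixCouplings K := by
  refine and_congr (posSemidef_opMatrix_iff _ S) (forall_congr' fun i => ?_)
  rw [← opMatrix_block, tupleMatrix]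
  exact (opMatrix_injective _ _).eq_iff

theorem exists_opMatrix_eq (M : Matrix (Σ i, Fin (Module.finrank ℝ (E i)))
    (Σ i, Fin (Module.finrank ℝ (E i))) ℝ) :
    ∃ S : PiLp 2 E →L[ℝ] PiLp 2 E, opMatrix (sumBasis E) (sumBasis E) S = M := by
  refine ⟨LinearMap.toContinuousLinearMap
    (Matrix.toLin (sumBasis E).toBasis (sumBasis E).toBasis M), ?_⟩
  rw [opMatrix, LinearMap.coe_toContinuousLinearMap, LinearMap.toMatrix_toLin]

theorem logDetSum_eq {d : Fin m → ℝ} (hd : ∀ j, 0 < d j) (B : ∀ j, PiLp 2 E →L[ℝ] E' j)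
    {S : PiLp 2 E →L[ℝ] PiLp 2 E} (hS : S.IsPositive) :
    logDetSum d B S = ENNReal.log (ENNReal.ofReal
      (detProd d (datumMatrix B) (opMatrix (sumBasis E) (sumBasis E) S))) := by
  have hpsd := (posSemidef_opMatrix_iff (sumBasis E) S).2 hS
  have hnn := fun j => (posSemidef_mul_mul_transpose hpsd (datumMatrix B j)).det_nonneg
  have hlog : ∀ (s : Finset (Fin m)) (f : Fin m → ℝ≥0∞),
      ENNReal.log (∏ j ∈ s, f j) = ∑ j ∈ s, ENNReal.log (f j) := by
    intro s f
    induction s using Finset.induction_on with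
    | empty => simp
    | insert a s ha ih => rw [Finset.prod_insert ha, Finset.sum_insert ha, ENNReal.log_mul_add, ih]
  rw [detProd, ENNReal.ofReal_prod_of_nonneg fun j _ => Real.rpow_nonneg (hnn j) _, hlog, logDetSum]
  refine Finset.sum_congr rfl fun j _ => ?_
  rw [← ENNReal.ofReal_rpow_of_nonneg (hnn j) (hd j).le, ENNReal.log_rpow, logDet,
    ← det_opMatrix (stdOrthonormalBasis ℝ (E' j)), opMatrix_comp _ (sumBasis E),
    opMatrix_comp _ (sumBasis E), opMatrix_adjoint, ← Matrix.mul_assoc]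
  rfl

theorem posDef_tupleMatrix {K : ∀ i, E i →L[ℝ] E i} (hK : K ∈ posDefTuples E) (i : Fin k) :
    (tupleMatrix E K i).PosDef :=
  posDef_opMatrix _ (hK i)

theorem log_ofReal_mono {x y : ℝ} (h : x ≤ y) :
    ENNReal.log (ENNReal.ofReal x) ≤ ENNReal.log (ENNReal.ofReal y) :=
  ENNReal.logOrderIso.monotone (ENNReal.ofReal_le_ofReal h)

theorem exists_logDetSum_eq {d : Fin m → ℝ} (hd : ∀ j, 0 < d j) (B : ∀ j, PiLp 2 E →L[ℝ] E' j)
    {K : ∀ i, E i →L[ℝ] E i} (hK : K ∈ posDefTuples E) :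
    ∃ S ∈ matrixCouplings K, logDetSum d B S =
      ENNReal.log (ENNReal.ofReal (maxDetProd d (datumMatrix B) (tupleMatrix E K))) := by
  obtain ⟨M, hM, hMe⟩ := exists_detProd_eq_maxDetProd hd (datumMatrix B) (posDef_tupleMatrix hK)
  obtain ⟨S, rfl⟩ := exists_opMatrix_eq M
  have hS := opMatrix_mem_gramCouplings_iff.1 hM
  exact ⟨S, hS, by rw [logDetSum_eq hd B hS.1, hMe]⟩

theorem logDetSum_le {d : Fin m → ℝ} (hd : ∀ j, 0 < d j) (B : ∀ j, PiLp 2 E →L[ℝ] E' j)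
    {K : ∀ i, E i →L[ℝ] E i} {S : PiLp 2 E →L[ℝ] PiLp 2 E} (hS : S ∈ matrixCouplings K) :
    logDetSum d B S ≤
      ENNReal.log (ENNReal.ofReal (maxDetProd d (datumMatrix B) (tupleMatrix E K))) := by
  rw [logDetSum_eq hd B hS.1]
  exact log_ofReal_mono (detProd_le_maxDetProd hd _ (opMatrix_mem_gramCouplings_iff.2 hS))

/-- Subtraction of the real number `∑ᵢ cᵢ log det Kᵢ` is written as addition of its negative, which
is continuous on `EReal × ℝ`. -/
theorem objectiveF_eq {d : Fin m → ℝ} (hd : ∀ j, 0 < d j) (B : ∀ j, PiLp 2 E →L[ℝ] E' j)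
    (c : Fin k → ℝ) {K : ∀ i, E i →L[ℝ] E i} (hK : K ∈ posDefTuples E) :
    objectiveF c d B K =
      ENNReal.log (ENNReal.ofReal (maxDetProd d (datumMatrix B) (tupleMatrix E K))) +
        ((-∑ i, c i * Real.log (tupleMatrix E K i).det : ℝ) : EReal) := by
  have hsup : (⨆ S ∈ matrixCouplings K, logDetSum d B S) =
      ENNReal.log (ENNReal.ofReal (maxDetProd d (datumMatrix B) (tupleMatrix E K))) := by
    refine le_antisymm (iSup₂_le fun S hS => logDetSum_le hd B hS) ?_
    obtain ⟨S, hS, hSe⟩ := exists_logDetSum_eq hd B hK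
    rw [← hSe]
    exact le_iSup₂ (f := fun S _ => logDetSum d B S) S hS
  have hsum : ∑ i, (c i : EReal) * logDet (K i) =
      ((∑ i, c i * Real.log (tupleMatrix E K i).det : ℝ) : EReal) := by
    rw [coe_finset_sum]
    refine Finset.sum_congr rfl fun i _ => ?_
    rw [logDet_eq_log (hK i), tupleMatrix, det_opMatrix, EReal.coe_mul]
  rw [objectiveF, hsup, hsum, sub_eq_add_neg, EReal.coe_neg]

theorem continuousOn_objectiveF {d : Fin m → ℝ} (hd : ∀ j, 0 < d j)
    (B : ∀ j, PiLp 2 E →L[ℝ] E' j) (c : Fin k → ℝ) :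
    ContinuousOn (objectiveF c d B) (posDefTuples E) := by
  have hT : Continuous (tupleMatrix E) :=
    continuous_pi fun i => (continuous_opMatrix _ _).comp (continuous_apply i)
  have h1 : ContinuousOn (fun K => ENNReal.log (ENNReal.ofReal
      (maxDetProd d (datumMatrix B) (tupleMatrix E K)))) (posDefTuples E) :=
    (ENNReal.continuous_log.comp ENNReal.continuous_ofReal).comp_continuousOn
      ((continuousOn_maxDetProd hd (datumMatrix B)).comp hT.continuousOn
        fun K hK => posDef_tupleMatrix hK)
  have h2 : ContinuousOn (fun K => -∑ i, c i * Real.log (tupleMatrix E K i).det)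
      (posDefTuples E) := by
    refine (continuousOn_finsetSum _ fun i _ => continuousOn_const.mul ?_).neg
    refine ContinuousOn.log ?_ fun K hK => (posDef_tupleMatrix hK i).det_pos.ne'
    exact (Continuous.matrix_det ((continuous_apply i).comp hT)).continuousOn
  refine ContinuousOn.congr (fun K hK => ?_) fun K hK => objectiveF_eq hd B c hK
  refine ContinuousAt.comp_continuousWithinAt (g := fun p : EReal × EReal => p.1 + p.2)
    (EReal.continuousAt_add (Or.inr ?_) (Or.inr ?_))
    ((h1 K hK).prodMk (continuous_coe_real_ereal.continuousAt.comp_continuousWithinAt (h2 K hK)))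
  · exact EReal.coe_ne_bot _
  · exact EReal.coe_ne_top _

theorem isGeodesic_tupleMatrix {γ : ℝ → ∀ i, E i →L[ℝ] E i}
    (hγ : IsGeodesic deltaTwoProd (posDefTuples E) γ) :
    IsGeodesic (fun K L => √(∑ i, matrixDeltaTwo (K i) (L i) ^ 2)) {K | ∀ i, (K i).PosDef}
      fun t => tupleMatrix E (γ t) := by
  have h : ∀ s ∈ Set.Icc (0 : ℝ) 1, ∀ t,
      √(∑ i, matrixDeltaTwo (tupleMatrix E (γ s) i) (tupleMatrix E (γ t) i) ^ 2) =
        deltaTwoProd (γ s) (γ t) := by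
    intro s hs t
    rw [deltaTwoProd]
    congr 1
    refine Finset.sum_congr rfl fun i _ => ?_
    rw [deltaTwo_eq_matrixDeltaTwo (stdOrthonormalBasis ℝ (E i)) (hγ.1 s hs i)]
    rfl
  refine ⟨fun t ht => posDef_tupleMatrix (hγ.1 t ht), fun s hs t ht => ?_⟩
  simp only [h s hs, h 0 (Set.left_mem_Icc.2 zero_le_one)]
  exact hγ.2 s hs t ht

theorem geodesicallyConvex_objectiveF {d : Fin m → ℝ} (hd : ∀ j, 0 < d j)
    (B : ∀ j, PiLp 2 E →L[ℝ] E' j) (c : Fin k → ℝ) :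
    GeodesicallyConvex deltaTwoProd (posDefTuples E) (objectiveF c d B) := by
  intro γ hγ t ht
  have hI0 : (0 : ℝ) ∈ Set.Icc (0 : ℝ) 1 := Set.left_mem_Icc.2 zero_le_one
  have hI1 : (1 : ℝ) ∈ Set.Icc (0 : ℝ) 1 := Set.right_mem_Icc.2 zero_le_one
  by_cases hB : ∀ j, Function.Injective (datumMatrix B j).vecMul
  · obtain ⟨N, h, hN, hγN⟩ := exists_diagonal_of_isGeodesic (isGeodesic_tupleMatrix hγ)
    have hreal : ∀ s ∈ Set.Icc (0 : ℝ) 1, objectiveF c d B (γ s) =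
        ((Real.log (maxDetProd d (datumMatrix B) (tupleMatrix E (γ s))) -
          ∑ i, c i * Real.log (tupleMatrix E (γ s) i).det : ℝ) : EReal) := by
      intro s hs
      rw [objectiveF_eq hd B c (hγ.1 s hs), ENNReal.log_ofReal_of_pos
        (maxDetProd_pos hd hB (posDef_tupleMatrix (hγ.1 s hs))), ← EReal.coe_add, sub_eq_add_neg]
    rw [hreal t ht, hreal 0 hI0, hreal 1 hI1, ← EReal.coe_mul, ← EReal.coe_mul, ← EReal.coe_add,
      EReal.coe_le_coe_iff]
    have hlin : ∑ i, c i * Real.log (tupleMatrix E (γ t) i).det =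
        (1 - t) * ∑ i, c i * Real.log (tupleMatrix E (γ 0) i).det +
          t * ∑ i, c i * Real.log (tupleMatrix E (γ 1) i).det := by
      rw [Finset.mul_sum, Finset.mul_sum, ← Finset.sum_add_distrib]
      refine Finset.sum_congr rfl fun i _ => ?_
      have h0 := hγN 0 hI0 i
      have h1 := hγN 1 hI1 i
      simp only [zero_mul, Real.exp_zero, diagonal_one, Matrix.mul_one] at h0
      simp only [one_mul] at h1
      rw [hγN t ht i, h0, h1, log_det_mul_diagonal_exp_mul_transpose (hN i)]
      ring
    have hlog := log_maxDetProd_le_of_geodesic (γ := fun t => tupleMatrix E (γ t)) hd hB hN hγN ht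
    rw [hlin]
    linarith
  -- If some `Bⱼ` is not surjective, then `F` is identically `-∞`.
  · obtain ⟨j, hj⟩ := not_forall.1 hB
    have hbot : objectiveF c d B (γ t) = ⊥ := by
      rw [objectiveF_eq hd B c (hγ.1 t ht),
        maxDetProd_eq_zero hd hj (posDef_tupleMatrix (hγ.1 t ht)), ENNReal.ofReal_zero,
        ENNReal.log_zero, EReal.bot_add]
    rw [hbot]
    exact bot_le

end Transfer

/-! ### The Gaussian constant -/

section GaussianConstant

variable {k m : ℕ}
  {E : Fin k → Type*} [∀ i, NormedAddCommGroup (E i)] [∀ i, InnerProductSpace ℝ (E i)]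
  [∀ i, FiniteDimensional ℝ (E i)] [∀ i, MeasurableSpace (E i)] [∀ i, BorelSpace (E i)]
  {E' : Fin m → Type*} [∀ j, NormedAddCommGroup (E' j)] [∀ j, InnerProductSpace ℝ (E' j)]
  [∀ j, FiniteDimensional ℝ (E' j)] [∀ j, MeasurableSpace (E' j)] [∀ j, BorelSpace (E' j)]

/-- Gaussian laws have finite entropy, so that the linear part of `D_g` is real. -/
theorem sum_mul_entropy_eq {μ : ∀ i, Measure (E i)} (hμ : ∀ i, μ i ∈ gaussianLaws (E i))
    (c : Fin k → ℝ) : ∑ i, (c i : EReal) * entropy (μ i) =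
      ((∑ i, c i * (entropy (μ i)).toReal : ℝ) : EReal) := by
  rw [coe_finset_sum]
  refine Finset.sum_congr rfl fun i _ => ?_
  rw [EReal.coe_mul, EReal.coe_toReal (hμ i).1.2.2.1 (hμ i).1.2.1]

theorem gaussianConstant_convex (d : Fin m → ℝ) (B : ∀ j, PiLp 2 E →L[ℝ] E' j)
    (c c' : Fin k → ℝ) {a b : ℝ} (ha : 0 ≤ a) (hb : 0 ≤ b) (hab : a + b = 1) :
    gaussianConstant (a • c + b • c') d B ≤
      (a : EReal) * gaussianConstant c d B + (b : EReal) * gaussianConstant c' d B := by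
  refine iSup₂_le fun μ hμ => ?_
  have hle : ∀ c : Fin k → ℝ, ((∑ i, c i * (entropy (μ i)).toReal : ℝ) : EReal) -
      maxCouplingEntropy d B μ ≤ gaussianConstant c d B := fun c => by
    rw [← sum_mul_entropy_eq hμ c]
    exact le_iSup₂ (f := fun (μ : ∀ i, Measure (E i))
      (_ : μ ∈ {μ : ∀ i, Measure (E i) | ∀ i, μ i ∈ gaussianLaws (E i)}) =>
      ∑ i, (c i : EReal) * entropy (μ i) - maxCouplingEntropy d B μ) μ hμ
  have h1 := hle c
  have h2 := hle c'
  rw [sum_mul_entropy_eq hμ]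
  generalize maxCouplingEntropy d B μ = M at h1 h2
  have ha' : (0 : EReal) ≤ a := EReal.coe_nonneg.2 ha
  have hb' : (0 : EReal) ≤ b := EReal.coe_nonneg.2 hb
  refine le_trans ?_ (add_le_add (mul_le_mul_of_nonneg_left h1 ha')
    (mul_le_mul_of_nonneg_left h2 hb'))
  -- If the inner maximum is `-∞`, both sides are `⊤` unless a weight vanishes, and then the other
  -- weight is `1`.
  induction M with
  | bot =>
    simp only [EReal.coe_sub_bot]
    rcases ha.eq_or_lt with rfl | ha0
    · have hb1 : b = 1 := by linarith
      subst hb1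
      simp
    · rcases hb.eq_or_lt with rfl | hb0
      · have ha1 : a = 1 := by linarith
        subst ha1
        simp
      · rw [EReal.coe_mul_top_of_pos ha0, EReal.coe_mul_top_of_pos hb0]
        simp
  | top =>
    simp
  | coe M =>
    norm_cast
    refine le_of_eq ?_
    simp only [Pi.add_apply, Pi.smul_apply, smul_eq_mul, add_mul, Finset.sum_add_distrib, mul_sub,
      Finset.mul_sum, mul_assoc]
    linear_combination M * hab

theorem lowerSemicontinuous_gaussianConstant (d : Fin m → ℝ) (B : ∀ j, PiLp 2 E →L[ℝ] E' j) :
    LowerSemicontinuous fun c : Fin k → ℝ => gaussianConstant c d B := by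
  refine lowerSemicontinuous_biSup fun μ hμ => Continuous.lowerSemicontinuous ?_
  simp only [sum_mul_entropy_eq hμ]
  generalize maxCouplingEntropy d B μ = M
  have hc : Continuous fun c : Fin k → ℝ => ∑ i, c i * (entropy (μ i)).toReal := by fun_prop
  induction M with
  | bot => simpa only [EReal.coe_sub_bot] using continuous_const
  | top => simpa only [EReal.sub_top] using continuous_const
  | coe M =>
    simp only [← EReal.coe_sub]
    exact continuous_coe_real_ereal.comp (hc.sub continuous_const)

end GaussianConstant

end BrascampLieb

theorem mainTheorem7 {k m : ℕ}
    (E : Fin k → Type*) [∀ i, NormedAddCommGroup (E i)] [∀ i, InnerProductSpace ℝ (E i)]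
    [∀ i, FiniteDimensional ℝ (E i)] [∀ i, MeasurableSpace (E i)] [∀ i, BorelSpace (E i)]
    (E' : Fin m → Type*) [∀ j, NormedAddCommGroup (E' j)] [∀ j, InnerProductSpace ℝ (E' j)]
    [∀ j, FiniteDimensional ℝ (E' j)] [∀ j, MeasurableSpace (E' j)] [∀ j, BorelSpace (E' j)]
    (d : Fin m → ℝ) (hd : ∀ j, 0 < d j) (B : ∀ j, PiLp 2 E →L[ℝ] E' j) :
    -- (i) convexity and lower semicontinuity of the Gaussian constant in `c`
    ((∀ (c c' : Fin k → ℝ) (a b : ℝ), 0 ≤ a → 0 ≤ b → a + b = 1 →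
        BrascampLieb.gaussianConstant (a • c + b • c') d B ≤
          (a : EReal) * BrascampLieb.gaussianConstant c d B +
            (b : EReal) * BrascampLieb.gaussianConstant c' d B) ∧
      LowerSemicontinuous fun c : Fin k → ℝ => BrascampLieb.gaussianConstant c d B) ∧
    -- (ii) the maximum in the definition of `F` is attained, and `F` is geodesically convex
    -- and continuous in the positive definite operators
    ((∀ K ∈ BrascampLieb.posDefTuples E, ∃ S ∈ BrascampLieb.matrixCouplings K,
        ∀ S' ∈ BrascampLieb.matrixCouplings K,
          BrascampLieb.logDetSum d B S' ≤ BrascampLieb.logDetSum d B S) ∧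
      ∀ c : Fin k → ℝ,
        BrascampLieb.GeodesicallyConvex BrascampLieb.deltaTwoProd (BrascampLieb.posDefTuples E)
          (BrascampLieb.objectiveF c d B) ∧
        ContinuousOn (BrascampLieb.objectiveF c d B) (BrascampLieb.posDefTuples E)) := by
  refine ⟨⟨fun c c' a b ha hb hab => BrascampLieb.gaussianConstant_convex d B c c' ha hb hab,
    BrascampLieb.lowerSemicontinuous_gaussianConstant d B⟩, fun K hK => ?_, fun c =>
    ⟨BrascampLieb.geodesicallyConvex_objectiveF hd B c,
      BrascampLieb.continuousOn_objectiveF hd B c⟩⟩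
  obtain ⟨S, hS, hSe⟩ := BrascampLieb.exists_logDetSum_eq hd B hK
  exact ⟨S, hS, fun S' hS' => hSe ▸ BrascampLieb.logDetSum_le hd B hS'⟩
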